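/- Let $1\le m<n$ be integers and let $Z_n=\{\zeta_1,\dots,\zeta_n\}$ and $Z_m=\{\xi_1,\dots,\xi_m\}$ be disjoint sets of $n$, respectively $m$, distinct points of the unit circle $\mathbb S^1$. Say that $Z_m$ strictly interlaces $Z_n$ if each open counterclockwise arc between two counterclockwise consecutive points of $Z_n$ contains at most one point of $Z_m$. For $N\ge1$, $\alpha_0,\dots,\alpha_{N-2}\in\mathbb C$ with $|\alpha_j|<1$ and $b\in\mathbb S^1$, let $\mathcal C(\alpha_0,\dots,\alpha_{N-2},b)$ be the $N\times N$ unitary pentadiagonal (CMV) matrix $\mathcal L\mathcal M$, where $\mathcal L$ and $\mathcal M$ are the $N\times N$ truncations of $\operatorname{diag}(\Theta_0,\Theta_2,\dots)$ and $\operatorname{diag}(1,\Theta_1,\Theta_3,\dots)$, with $$\Theta_j=\begin{pmatrix}\overline{\alpha_j}&\rho_j\\ \rho_j&-\alpha_j\end{pmatrix},\qquad \rho_j=\sqrt{1-|\alpha_j|^2},\qquad \alpha_{N-1}:=b .$$ A solution is a tuple $(\alpha_0,\dots,\alpha_{n-2},b_n,b_m)$ with $|\alpha_j|<1$ and $|b_n|=|b_m|=1$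 such that $$\sigma\bigl(\mathcal C(\alpha_0,\dots,\alpha_{n-2},b_n)\bigr)=Z_n,\qquad \sigma\bigl(\mathcal C(\alpha_0,\dots,\alpha_{m-2},b_m)\bigr)=Z_m .$$ Put $\Psi_n(z)=\prod_{j=1}^n(z-\zeta_j)$ and $\Psi_m(z)=\prod_{k=1}^m(z-\xi_k)$, and let $\mathcal W_{>0}$ be the set of all $\omega\in\mathbb R^n$ with $\omega_j>0$ for all $j$ and $$\sum_{j=1}^n\omega_j\,\Psi_m(\zeta_j)\,\zeta_j^{-k}=0,\qquad k=1,\dots,m-1 .$$ Then: 1. A solution exists if and only if $Z_m$ strictly interlaces $Z_n$. 2. If $Z_m$ strictly interlaces $Z_n$, then $\mathcal W_{>0}\neq\emptyset$ and the solution is not unique. 3. Let $\omega\in\mathcal W_{>0}$ and $\nu=\sum_{j=1}^n\omega_j\delta_{\zeta_j}$. Then the truncated trigonometric moments $\mu_k=\int z^k\,d\nu$, $|k|\le n-1$, determine the Verblunsky coefficients $\alpha_0,\dots,\alpha_{n-2}$ of $\nu$, where $\alpha_k=-\overline{\Phi_{k+1}(0)}$ and $\Phi_k$ is the monic orthogonal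 polynomial of degree $k$ of $\nu$. Explicitly, $\alpha_k=f_k(0)$ for the iterates of the Schur algorithm $$f_0=\frac{\sum_{j=0}^{n-2}\mu_{-j-1}z^j}{\sum_{j=0}^{n-1}\mu_{-j}z^j},\qquad f_{k+1}=\frac1z\,\frac{f_k-f_k(0)}{1-\overline{f_k(0)}\,f_k}$$ (as formal power series). Together with $b_n=-\overline{\Psi_n(0)}$ and $b_m=-\overline{\Psi_m(0)}$ they form a solution. 4. Conversely, every solution $(\alpha_0,\dots,\alpha_{n-2},b_n,b_m)$ arises in this way: $b_n=-\overline{\Psi_n(0)}$, $b_m=-\overline{\Psi_m(0)}$, and there is $\omega\in\mathcal W_{>0}$ such that $\alpha_0,\dots,\alpha_{n-2}$ are the Verblunsky coefficients of $\nu=\sum_j\omega_j\delta_{\zeta_j}$. -/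

import Mathlib

open Polynomial MeasureTheory
open scoped ComplexConjugate

noncomputable section

/-! ### Strict interlacing on the unit circle -/

/-- The open counterclockwise arc of the unit circle from `p` to `q`, for `p`, `q` on the circle:
the points `p * exp (i s)` with `0 < s < t`, where `q = p * exp (i t)` and `0 < t ≤ 2π`.
(For `p = q` this is the circle without `p`.) -/
def openArc (p q : ℂ) : Set ℂ :=
  {z | ∃ s t : ℝ, 0 < s ∧ s < t ∧ t ≤ 2 * Real.pi ∧
    q = p * Complex.exp (t * Complex.I) ∧ z = p * Complex.exp (s * Complex.I)}

/-- `Zm` strictly interlaces `Zn`: whenever `p`, `q` are counterclockwise consecutive points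
of `Zn` (no point of `Zn` lies on the open arc from `p` to `q`), that open arc contains at most
one point of `Zm`. -/
def StrictlyInterlaces (Zm Zn : Set ℂ) : Prop :=
  ∀ p ∈ Zn, ∀ q ∈ Zn, openArc p q ∩ Zn = ∅ → (openArc p q ∩ Zm).Subsingleton

/-! ### Unitary pentadiagonal (CMV) matrices -/

/-- The complementary parameter `ρ = √(1 - |a|²)`. -/
def rhoC (a : ℂ) : ℂ := (Real.sqrt (1 - ‖a‖ ^ 2) : ℂ)

/-- The `N × N` truncation of the block diagonal matrix `diag (Θ₀, Θ₂, Θ₄, …)`, where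
`Θ_j = [[conj γ_j, ρ_j], [ρ_j, -γ_j]]` acts on the coordinates `j, j + 1`. -/
def cmvL (γ : ℕ → ℂ) (N : ℕ) : Matrix (Fin N) (Fin N) ℂ := fun i j =>
  if i = j then (if Even (i : ℕ) then conj (γ i) else -γ ((i : ℕ) - 1))
  else if Even (i : ℕ) ∧ (j : ℕ) = i + 1 then rhoC (γ i)
  else if Even (j : ℕ) ∧ (i : ℕ) = j + 1 then rhoC (γ j)
  else 0

/-- The `N × N` truncation of the block diagonal matrix `diag (1, Θ₁, Θ₃, …)`, where
`Θ_j = [[conj γ_j, ρ_j], [ρ_j, -γ_j]]` acts on the coordinates `j, j + 1`. -/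
def cmvM (γ : ℕ → ℂ) (N : ℕ) : Matrix (Fin N) (Fin N) ℂ := fun i j =>
  if i = j then
    (if (i : ℕ) = 0 then 1 else if Odd (i : ℕ) then conj (γ i) else -γ ((i : ℕ) - 1))
  else if Odd (i : ℕ) ∧ (j : ℕ) = i + 1 then rhoC (γ i)
  else if Odd (j : ℕ) ∧ (i : ℕ) = j + 1 then rhoC (γ j)
  else 0

/-- The parameter list `α_0, …, α_{N-2}, b` as a sequence. Its last relevant entry, at index
`N - 1`, is `b`; the corresponding block `Θ_{N-1}` is cut down to the `1 × 1` block `conj b`. -/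
def cmvParams {N : ℕ} (α : Fin (N - 1) → ℂ) (b : ℂ) : ℕ → ℂ := fun j =>
  if h : j < N - 1 then α ⟨j, h⟩ else b

/-- The pentadiagonal matrix `C(α_0, …, α_{N-2}, b)` of order `N`, which is unitary
when `|α_j| < 1` and `|b| = 1`. -/
def cmvMatrix {N : ℕ} (α : Fin (N - 1) → ℂ) (b : ℂ) : Matrix (Fin N) (Fin N) ℂ :=
  cmvL (cmvParams α b) N * cmvM (cmvParams α b) N

/-- `(α, bn, bm)` solves the two-spectra problem for `Zn`, `Zm`:
`σ(C(α_0, …, α_{n-2}, bn)) = Zn` and `σ(C(α_0, …, α_{m-2}, bm)) = Zm`. -/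
structure IsTwoSpectraSolution {m n : ℕ} (hmn : m < n) (Zn Zm : Set ℂ)
    (α : Fin (n - 1) → ℂ) (bn bm : ℂ) : Prop where
  alpha_lt : ∀ j, ‖α j‖ < 1
  bn_norm : ‖bn‖ = 1
  bm_norm : ‖bm‖ = 1
  spectrum_n : spectrum ℂ (cmvMatrix (N := n) α bn) = Zn
  spectrum_m : spectrum ℂ (cmvMatrix (N := m)
    (fun j => α (Fin.castLE (Nat.sub_le_sub_right hmn.le 1) j)) bm) = Zm

/-! ### The Vandermonde-type system and its positive solutions -/

/-- The monic polynomial `∏ (z - ζ_j)`. -/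
def nodePoly {N : ℕ} (ζ : Fin N → ℂ) : ℂ[X] := ∏ j, (X - C (ζ j))

/-- The boundary parameter `b = -conj (Ψ(0))` with `Ψ(z) = ∏ (z - ζ_j)`. -/
def boundaryParam {N : ℕ} (ζ : Fin N → ℂ) : ℂ := -conj ((nodePoly ζ).eval 0)

/-- The strictly positive solutions `ω` of
`∑_j ω_j Ψ_m(ζ_j) ζ_j^{-k} = 0`, `k = 1, …, m - 1`, where `Ψ_m(z) = ∏ (z - ξ_k)`. -/
def positiveWeights {n m : ℕ} (ζ : Fin n → ℂ) (ξ : Fin m → ℂ) : Set (Fin n → ℝ) :=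
  {ω | (∀ j, 0 < ω j) ∧ ∀ k : ℕ, 1 ≤ k → k + 1 ≤ m →
    ∑ j, (ω j : ℂ) * (nodePoly ξ).eval (ζ j) * ζ j ^ (-(k : ℤ)) = 0}

/-- The discrete measure `∑_j ω_j δ_{ζ_j}`. -/
def nodeMeasure {n : ℕ} (ω : Fin n → ℝ) (ζ : Fin n → ℂ) : Measure ℂ :=
  ∑ j, ENNReal.ofReal (ω j) • Measure.dirac (ζ j)

/-! ### Orthogonal polynomials, moments, Verblunsky coefficients, Schur algorithm -/

/-- `Φ` is the monic orthogonal polynomial of degree `k` of `ν`. -/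
structure IsMonicOPUC (ν : Measure ℂ) (k : ℕ) (Φ : ℂ[X]) : Prop where
  monic : Φ.Monic
  natDegree_eq : Φ.natDegree = k
  orthogonal : ∀ l < k, ∫ z, Φ.eval z * conj (z ^ l) ∂ν = 0

/-- `α_0, …, α_{n-2}` are the first `n - 1` Verblunsky coefficients of `ν`:
`α_k = -conj (Φ_{k+1}(0))`. -/
def HasVerblunskyCoeffs (ν : Measure ℂ) {n : ℕ} (α : Fin (n - 1) → ℂ) : Prop :=
  ∀ k : Fin (n - 1), ∃ Φ : ℂ[X], IsMonicOPUC ν ((k : ℕ) + 1) Φ ∧ α k = -conj (Φ.eval 0)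

/-- The trigonometric moment `μ_k = ∫ z^k dν`. -/
def trigMoment (ν : Measure ℂ) (k : ℤ) : ℂ := ∫ z, z ^ k ∂ν

/-- The iterates of the Schur algorithm, as formal power series, for a sequence `c_0, c_1, …`
where `c_k` stands for `∫ z^{-k} dν`. With `F = c_0 + 2 ∑_{k ≥ 1} c_k X^k` (the Carathéodory
function), the Schur function `f_0` is given by `X f_0 = (F - c_0) / (F + c_0)`, that is
`f_0 = (∑ c_{k+1} X^k) / (∑ c_k X^k)`; then
`f_{k+1} = X⁻¹ (f_k - γ_k) / (1 - conj γ_k f_k)` with `γ_k = f_k(0)`. -/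
def schurIterate (c : ℕ → ℂ) : ℕ → PowerSeries ℂ
  | 0 => PowerSeries.mk (fun j => c (j + 1)) * (PowerSeries.mk c)⁻¹
  | k + 1 =>
    PowerSeries.mk (fun j => PowerSeries.coeff (j + 1) (schurIterate c k)) *
      (1 - PowerSeries.C (conj (PowerSeries.constantCoeff (schurIterate c k))) *
        schurIterate c k)⁻¹

/-- The parameters `γ_0, …, γ_{n-2}` that the Schur algorithm computes from the moments
`μ_k`, `|k| ≤ n - 1` (where `μ_k` and `μ_{-k}` are conjugate to each other); the other moments
are not used. -/
def schurParams (n : ℕ) (μ : ℤ → ℂ) : Fin (n - 1) → ℂ := fun k =>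
  PowerSeries.constantCoeff
    (schurIterate (fun j => if j < n then μ (-(j : ℤ)) else 0) (k : ℕ))

end

/-!
A CMV matrix `L M` has the factorization `z - L M = L (z L^* - M)` with a tridiagonal second
factor. Expanding its leading minors shows that the spectrum of `C(α_0, …, α_{N-2}, b)` is the
zero set of the last polynomial of the Szegő recursion, `z Φ_{N-1} - conj b Φ_{N-1}^*`
(`spectrum_cmv`). Since the prescribed spectra are simple, the two-spectra problem asks for a
Szegő recursion with `z Φ_{n-1} - conj bn Φ_{n-1}^* = Ψ_n` and `z Φ_{m-1} - conj bm Φ_{m-1}^* =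
Ψ_m` (`isTwoSpectraSolution_iff`).

Given a solution, the Christoffel–Darboux formula shows that the polynomials `Φ_k`, `k < n`, are
orthogonal for the measure on `Z_n` with the Christoffel weights, which are positive
(`isSzegoSeq_christoffelWeight`); then `Ψ_m` is orthogonal to `z, …, z^{m-1}`, which is the linear
system for the weights. Conversely, for a measure with positive weights on `Z_n` the monic
orthogonal polynomials satisfy a Szegő recursion with coefficients in the disc, and any monic
polynomial of degree `k + 1 ≤ n` orthogonal to `z, …, z^k` is one step of the recursion from `Φ_k`
(`IsSzegoSeq.eq_of_orthogonal`). This applies to `Ψ_m` by the linear system and to `Ψ_n` because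
it vanishes at the nodes, so the Verblunsky coefficients solve the problem. They are found by the
Schur algorithm from the moments because a Schur step acts on the power series with coefficients
`⟨Φ_k^*, z^{j+k+1}⟩` and `⟨Φ_k, z^{j+k}⟩` as the Szegő recursion does
(`IsSzegoSeq.schurIterate_mul_eq`).

Solvability is thus the existence of positive weights. If two points of `Z_m` share an arc of
`Z_n`, pairing `Ψ_m` with a multiple of the complementary factor gives a vanishing sum of nonzero
terms of equal argument (`strictlyInterlaces_of_mem_positiveWeights`). If `Z_m` strictly
interlaces `Z_n`, each arc of `Z_m` contains a node; choosing one node on each arc gives an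
explicit solution of the linear system with positive weights at the chosen nodes
(`exists_weights_of_interlaced`), and sums over such choices are positive everywhere. As `m < n`,
some arc contains two nodes, so there are two non-proportional positive solutions, and these have
different Verblunsky coefficients since the orthogonal polynomials determine the weights up to a
factor (`IsSzegoSeq.proportional`).
-/

/-! ### The Szegő recursion -/

/-- The pair `(Φ_k, Φ_k^*)` generated from `(1, 1)` by the Szegő recursion
`Φ_{k+1} = z Φ_k - conj a_k Φ_k^*`, `Φ_{k+1}^* = Φ_k^* - a_k z Φ_k`. -/
noncomputable def szegoPair (a : ℕ → ℂ) : ℕ → ℂ[X] × ℂ[X]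
  | 0 => (1, 1)
  | k + 1 => (X * (szegoPair a k).1 - C (conj (a k)) * (szegoPair a k).2,
      (szegoPair a k).2 - C (a k) * (X * (szegoPair a k).1))

/-- The monic polynomial `Φ_k` of the Szegő recursion. -/
noncomputable def szego (a : ℕ → ℂ) (k : ℕ) : ℂ[X] := (szegoPair a k).1

/-- The reversed polynomial `Φ_k^*` of the Szegő recursion. -/
noncomputable def szegoStar (a : ℕ → ℂ) (k : ℕ) : ℂ[X] := (szegoPair a k).2

@[simp] lemma szego_zero (a : ℕ → ℂ) : szego a 0 = 1 := rfl

@[simp] lemma szegoStar_zero (a : ℕ → ℂ) : szegoStar a 0 = 1 := rfl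

lemma szego_succ (a : ℕ → ℂ) (k : ℕ) :
    szego a (k + 1) = X * szego a k - C (conj (a k)) * szegoStar a k := rfl

lemma szegoStar_succ (a : ℕ → ℂ) (k : ℕ) :
    szegoStar a (k + 1) = szegoStar a k - C (a k) * (X * szego a k) := rfl

lemma szegoPair_congr {a b : ℕ → ℂ} {k : ℕ} (h : ∀ j < k, a j = b j) :
    szegoPair a k = szegoPair b k := by
  induction k with
  | zero => rfl
  | succ k ih =>
    simp only [szegoPair, ih fun j hj => h j (hj.trans k.lt_succ_self), h k k.lt_succ_self]

lemma szego_congr {a b : ℕ → ℂ} {k : ℕ} (h : ∀ j < k, a j = b j) : szego a k = szego b k := by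
  rw [szego, szegoPair_congr h, szego]

lemma szegoStar_congr {a b : ℕ → ℂ} {k : ℕ} (h : ∀ j < k, a j = b j) :
    szegoStar a k = szegoStar b k := by
  rw [szegoStar, szegoPair_congr h, szegoStar]

lemma szego_monic_natDegree (a : ℕ → ℂ) (k : ℕ) :
    (szego a k).Monic ∧ (szego a k).natDegree = k ∧ (szegoStar a k).natDegree ≤ k := by
  induction k with
  | zero => simp
  | succ k ih =>
    obtain ⟨h1, h2, h3⟩ := ih
    have hm : (X * szego a k).Monic := monic_X.mul h1
    have hd : (X * szego a k).natDegree = k + 1 := by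
      rw [natDegree_X_mul h1.ne_zero, h2]
    have hlt : (C (conj (a k)) * szegoStar a k).degree < (X * szego a k).degree := by
      refine (degree_le_natDegree.trans_lt ?_)
      rw [degree_eq_natDegree hm.ne_zero, hd]
      exact_mod_cast ((natDegree_C_mul_le _ _).trans h3).trans_lt k.lt_succ_self
    refine ⟨hm.sub_of_left hlt, ?_, ?_⟩
    · rw [szego_succ, natDegree_sub_eq_left_of_natDegree_lt, hd]
      rw [hd]
      exact ((natDegree_C_mul_le _ _).trans h3).trans_lt k.lt_succ_self
    · rw [szegoStar_succ]
      exact (natDegree_sub_le _ _).trans (max_le (h3.trans k.le_succ)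
        ((natDegree_C_mul_le _ _).trans hd.le))

lemma szego_monic (a : ℕ → ℂ) (k : ℕ) : (szego a k).Monic := (szego_monic_natDegree a k).1

lemma szego_natDegree (a : ℕ → ℂ) (k : ℕ) : (szego a k).natDegree = k :=
  (szego_monic_natDegree a k).2.1

lemma szegoStar_natDegree_le (a : ℕ → ℂ) (k : ℕ) : (szegoStar a k).natDegree ≤ k :=
  (szego_monic_natDegree a k).2.2

lemma szegoStar_eval_zero (a : ℕ → ℂ) (k : ℕ) : (szegoStar a k).eval 0 = 1 := by
  induction k with
  | zero => simp
  | succ k ih => simp [szegoStar_succ, ih]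

lemma szego_succ_eval_zero (a : ℕ → ℂ) (k : ℕ) : (szego a (k + 1)).eval 0 = -conj (a k) := by
  simp [szego_succ, szegoStar_eval_zero]

lemma mul_conj_of_norm_one {z : ℂ} (hz : ‖z‖ = 1) : z * conj z = 1 := by
  rw [Complex.mul_conj, Complex.normSq_eq_norm_sq, hz]; norm_num

/-- On the unit circle `Φ_k^*` is the reversed polynomial of `Φ_k`. -/
lemma szegoStar_eval (a : ℕ → ℂ) (k : ℕ) {z : ℂ} (hz : ‖z‖ = 1) :
    (szegoStar a k).eval z = z ^ k * conj ((szego a k).eval z) := by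
  induction k with
  | zero => simp
  | succ k ih =>
    have h1 := mul_conj_of_norm_one hz
    have h2 : z ^ k * conj z ^ k = 1 := by rw [← mul_pow, h1, one_pow]
    simp only [szego_succ, szegoStar_succ, eval_sub, eval_mul, eval_C, eval_X, map_sub, map_mul,
      Complex.conj_conj, ih, map_pow]
    linear_combination (-conj ((szego a k).eval z) * z ^ k) * h1 +
      (a k * z * (szego a k).eval z) * h2

/-! ### The characteristic polynomial of a CMV matrix -/

/-- Expansion of the determinant of a tridiagonal matrix along its last row and column. -/
lemma det_tridiagonal_succ_succ (f : ℕ → ℕ → ℂ)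
    (hf : ∀ i j, i + 1 < j ∨ j + 1 < i → f i j = 0) (k : ℕ) :
    (Matrix.of fun i j : Fin (k + 2) => f i j).det =
      f (k + 1) (k + 1) * (Matrix.of fun i j : Fin (k + 1) => f i j).det -
      f k (k + 1) * f (k + 1) k * (Matrix.of fun i j : Fin k => f i j).det := by
  rw [Matrix.det_succ_row _ (Fin.last _), Fin.sum_univ_castSucc, Fin.sum_univ_castSucc,
    Finset.sum_eq_zero, zero_add]
  · have h1 : (Matrix.of fun i j : Fin (k + 2) => f i j).submatrix (Fin.last (k + 1)).succAbove
        (Fin.last (k + 1)).succAbove = Matrix.of fun i j : Fin (k + 1) => f i j := by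
      ext i j; simp
    have h2 : ((Matrix.of fun i j : Fin (k + 2) => f i j).submatrix (Fin.last (k + 1)).succAbove
        (Fin.last k).castSucc.succAbove).det =
        f k (k + 1) * (Matrix.of fun i j : Fin k => f i j).det := by
      rw [Matrix.det_succ_column _ (Fin.last _), Fin.sum_univ_castSucc, Finset.sum_eq_zero,
        zero_add]
      · have h3 : (((Matrix.of fun i j : Fin (k + 2) => f i j).submatrix
            (Fin.last (k + 1)).succAbove (Fin.last k).castSucc.succAbove).submatrix
            (Fin.last k).succAbove (Fin.last k).succAbove) =
            Matrix.of fun i j : Fin k => f i j := by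
          ext i j
          have : (Fin.last k).castSucc.succAbove j.castSucc = j.castSucc.castSucc := by
            rw [Fin.succAbove_of_castSucc_lt]
            simp [Fin.lt_def]
          simp [this]
        rw [h3]
        have : (Fin.last k).castSucc.succAbove (Fin.last k) = Fin.last (k + 1) := by
          rw [Fin.succAbove_of_le_castSucc _ _ le_rfl]; rfl
        simp [this, ← two_mul]
      · intro i _
        have : (Fin.last k).castSucc.succAbove (Fin.last k) = Fin.last (k + 1) := by
          rw [Fin.succAbove_of_le_castSucc _ _ le_rfl]; rfl
        simp [this, hf i (k + 1) (Or.inl (by have := i.2; omega))]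
    rw [h1, h2]
    simp only [Matrix.of_apply, Fin.val_last, Fin.val_castSucc, ← two_mul, pow_mul]
    have : (-1 : ℂ) ^ (k + 1 + k) = -1 := by
      rw [show k + 1 + k = 2 * k + 1 by ring, pow_succ, pow_mul]; simp
    rw [this]
    norm_num
    ring
  · intro i _
    simp [hf (k + 1) i (Or.inr (by have := i.2; omega))]

/-- The entries of the tridiagonal pencil `z L^* - M`, as functions on `ℕ × ℕ`. -/
noncomputable def cmvPencil (γ : ℕ → ℂ) (z : ℂ) (i j : ℕ) : ℂ :=
  if i = j then
    (if Even i then z * γ i + (if i = 0 then -1 else γ (i - 1))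
      else -z * conj (γ (i - 1)) - conj (γ i))
  else if j = i + 1 then (if Even i then z * rhoC (γ i) else -rhoC (γ i))
  else if i = j + 1 then (if Even j then z * rhoC (γ j) else -rhoC (γ j))
  else 0

lemma conj_rhoC (a : ℂ) : conj (rhoC a) = rhoC a := Complex.conj_ofReal _

lemma rhoC_mul_self {a : ℂ} (ha : ‖a‖ ≤ 1) : rhoC a * rhoC a = 1 - a * conj a := by
  rw [rhoC, ← Complex.ofReal_mul, Real.mul_self_sqrt (by nlinarith [norm_nonneg a]),
    Complex.mul_conj, Complex.normSq_eq_norm_sq]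
  push_cast; ring

/-- The leading minors of `z L^* - M` are, up to sign, alternately `Φ_k (z)` and `Φ_k^* (z)`. -/
lemma det_cmvPencil (γ : ℕ → ℂ) (z : ℂ) (k : ℕ) (hγ : ∀ j < 2 * k, ‖γ j‖ ≤ 1) :
    (Matrix.of fun i j : Fin (2 * k) => cmvPencil γ z i j).det =
        (-1) ^ k * (szego γ (2 * k)).eval z ∧
      (Matrix.of fun i j : Fin (2 * k + 1) => cmvPencil γ z i j).det =
        (-1) ^ (k + 1) * (szegoStar γ (2 * k + 1)).eval z := by
  have htri : ∀ i j, i + 1 < j ∨ j + 1 < i → cmvPencil γ z i j = 0 := by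
    intro i j h
    simp only [cmvPencil]
    split_ifs <;> first | rfl | omega
  induction k with
  | zero =>
    simp [cmvPencil, szegoStar_succ]
    ring
  | succ k ih =>
    obtain ⟨h0, h1⟩ := ih fun j hj => hγ j (by omega)
    have hρ1 := rhoC_mul_self (hγ (2 * k) (by omega))
    have hρ2 := rhoC_mul_self (hγ (2 * k + 1) (by omega))
    have hodd : ¬ Even (2 * k + 1) := by simp
    have heven : Even (2 * k + 1 + 1) := by simp [Nat.even_add_one]
    have hne : ¬ 2 * k = 2 * k + 1 + 1 := by omega
    have h2 : (Matrix.of fun i j : Fin (2 * k + 2) => cmvPencil γ z i j).det =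
        (-1) ^ (k + 1) * (szego γ (2 * k + 2)).eval z := by
      rw [det_tridiagonal_succ_succ _ htri, h0, h1]
      simp [cmvPencil, szegoStar_succ, szego_succ, hne]
      rw [pow_succ]
      linear_combination (-(z ^ 2 * (-1) ^ k * (szego γ (2 * k)).eval z)) * hρ1
    refine ⟨h2, ?_⟩
    rw [show 2 * (k + 1) + 1 = (2 * k + 1) + 2 by ring, det_tridiagonal_succ_succ _ htri, h1, h2]
    simp [cmvPencil, szegoStar_succ, szego_succ, heven, hodd]
    rw [pow_succ (-1 : ℂ) (k + 1)]
    linear_combination (-((-1) ^ (k + 1) * (eval z (szegoStar γ (2 * k)) - γ (2 * k) *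
      (z * eval z (szego γ (2 * k)))))) * hρ2

lemma cmvL_conjTranspose_apply (γ : ℕ → ℂ) (N : ℕ) (i j : Fin N) :
    (cmvL γ N).conjTranspose i j =
      if i = j then (if Even (i : ℕ) then γ i else -conj (γ ((i : ℕ) - 1)))
      else if Even (i : ℕ) ∧ (j : ℕ) = i + 1 then rhoC (γ i)
      else if Even (j : ℕ) ∧ (i : ℕ) = j + 1 then rhoC (γ j)
      else 0 := by
  simp only [Matrix.conjTranspose_apply, cmvL, RCLike.star_def]
  by_cases hij : i = j
  · subst hij; simp only [if_true]; split_ifs <;> simp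
  · simp only [hij, Ne.symm hij, if_false]
    split_ifs <;> first | (exfalso; omega) | simp [conj_rhoC]

lemma cmvL_mul_conjTranspose (γ : ℕ → ℂ) (N : ℕ) (hγ : ∀ j < N, ‖γ j‖ ≤ 1)
    (hN : ‖γ (N - 1)‖ = 1) : cmvL γ N * (cmvL γ N).conjTranspose = 1 := by
  ext i j
  rw [Matrix.mul_apply]
  simp only [cmvL_conjTranspose_apply]
  have hi := i.2
  have hj := j.2
  by_cases hev : Even (i : ℕ)
  · have hρ := rhoC_mul_self (hγ i hi)
    have hodd : ¬ Even ((i : ℕ) + 1) := by simpa [Nat.even_add_one] using hev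
    by_cases hlast : (i : ℕ) + 1 < N
    · rw [Fintype.sum_eq_add i ⟨i + 1, hlast⟩ (by simp [Fin.ext_iff])]
      · by_cases h1 : j = i
        · subst h1
          simp [cmvL, hev, hodd, Fin.ext_iff]
          linear_combination hρ
        · by_cases h2 : (j : ℕ) = i + 1
          · have : j = ⟨i + 1, hlast⟩ := Fin.ext h2
            subst this
            simp [cmvL, hev, hodd, Fin.ext_iff]
            ring
          · simp [cmvL, hev, hodd, Fin.ext_iff, Matrix.one_apply, h2, Ne.symm h2]
            grind
      · rintro k ⟨h1, h2⟩
        simp only [Fin.ext_iff, ne_eq] at h1 h2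
        simp [cmvL, hev, Fin.ext_iff, Ne.symm h1, h2]
        grind
    · have hb := mul_conj_of_norm_one hN
      rw [show N - 1 = (i : ℕ) by omega] at hb
      rw [Fintype.sum_eq_single i]
      · by_cases h1 : j = i
        · subst h1
          simp [cmvL, hev]
          linear_combination hb
        · have : ¬ (i : ℕ) = j := fun h => h1 (Fin.ext h.symm)
          simp [cmvL, hev, Fin.ext_iff, this]
          grind
      · intro k h1
        have := k.2
        have : ¬ (i : ℕ) = k := fun h => h1 (Fin.ext h.symm)
        simp [cmvL, hev, Fin.ext_iff, this]
        grind
  · obtain ⟨l, hl⟩ := Nat.not_even_iff_odd.mp hev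
    have hlN : 2 * l < N := by omega
    have hρ := rhoC_mul_self (hγ (2 * l) hlN)
    have hodd : ¬ Even (2 * l + 1) := by simp
    rw [Fintype.sum_eq_add i ⟨2 * l, hlN⟩ (by simp [Fin.ext_iff]; omega)]
    · by_cases h1 : j = i
      · subst h1
        simp [cmvL, hl, Fin.ext_iff]
        linear_combination hρ
      · by_cases h2 : (j : ℕ) = 2 * l
        · have : j = ⟨2 * l, hlN⟩ := Fin.ext h2
          subst this
          simp [cmvL, hl, Fin.ext_iff]
          ring
        · have h3 : ¬ (j : ℕ) = 2 * l + 1 := fun h => h1 (Fin.ext (h.trans hl.symm))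
          simp [cmvL, hl, Fin.ext_iff, Ne.symm h3, h3]
          grind
    · rintro k ⟨h1, h2⟩
      simp only [Fin.ext_iff, ne_eq, hl] at h1 h2
      simp [cmvL, hl, Fin.ext_iff, Ne.symm h1]
      grind

lemma smul_conjTranspose_sub_cmvM (γ : ℕ → ℂ) (N : ℕ) (z : ℂ) :
    z • (cmvL γ N).conjTranspose - cmvM γ N =
      Matrix.of fun i j : Fin N => cmvPencil γ z i j := by
  ext i j
  simp only [Matrix.sub_apply, Matrix.smul_apply, cmvL_conjTranspose_apply, Matrix.of_apply,
    cmvM, cmvPencil, Fin.ext_iff, smul_eq_mul]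
  split_ifs <;> first | (exfalso; grind) | ring

lemma szegoStar_eq_of_norm_one (γ : ℕ → ℂ) (k : ℕ) (hb : ‖γ k‖ = 1) :
    szegoStar γ (k + 1) = -C (γ k) * szego γ (k + 1) := by
  have h : C (γ k) * C (conj (γ k)) = 1 := by rw [← C_mul, mul_conj_of_norm_one hb, C_1]
  rw [szegoStar_succ, szego_succ]
  linear_combination (-szegoStar γ k) * h

/-- The spectrum of a CMV matrix is the zero set of the last polynomial `Φ_N` of the Szegő
recursion with the boundary parameter as last coefficient. This comes from the factorization
`z - L M = L (z L^* - M)`, whose second factor is tridiagonal. -/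
lemma spectrum_cmv (γ : ℕ → ℂ) (N : ℕ) (hγ : ∀ j < N, ‖γ j‖ ≤ 1)
    (hb : ‖γ N‖ = 1) :
    spectrum ℂ (cmvL γ (N + 1) * cmvM γ (N + 1)) = {z | (szego γ (N + 1)).eval z = 0} := by
  have hγ' : ∀ j < N + 1, ‖γ j‖ ≤ 1 := fun j hj => by
    rcases Nat.lt_succ_iff_lt_or_eq.mp hj with h | h
    · exact hγ j h
    · rw [h, hb]
  have hL := cmvL_mul_conjTranspose γ (N + 1) hγ' (by simpa using hb)
  ext z
  have hdet : (algebraMap ℂ (Matrix (Fin (N + 1)) (Fin (N + 1)) ℂ) z -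
      cmvL γ (N + 1) * cmvM γ (N + 1)).det = (cmvL γ (N + 1)).det *
        (Matrix.of fun i j : Fin (N + 1) => cmvPencil γ z i j).det := by
    rw [← smul_conjTranspose_sub_cmvM, ← Matrix.det_mul, Matrix.mul_sub, Matrix.mul_smul, hL,
      Algebra.algebraMap_eq_smul_one]
  have hL0 : (cmvL γ (N + 1)).det ≠ 0 := by
    intro h
    have := congrArg Matrix.det hL
    rw [Matrix.det_mul, h, zero_mul, Matrix.det_one] at this
    exact zero_ne_one this
  have hb0 : γ N ≠ 0 := by
    intro h; simp [h] at hb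
  rw [spectrum.mem_iff, Matrix.isUnit_iff_isUnit_det, isUnit_iff_ne_zero, not_not, hdet,
    mul_eq_zero, or_iff_right hL0, Set.mem_ofPred_eq]
  rcases Nat.even_or_odd' (N + 1) with ⟨k, hk | hk⟩
  · rw [hk, (det_cmvPencil γ z k fun j hj => hγ' j (by omega)).1]
    simp
  · have hstar := congrArg (eval z) (szegoStar_eq_of_norm_one γ N hb)
    rw [hk] at hstar ⊢
    rw [(det_cmvPencil γ z k fun j hj => hγ' j (by omega)).2, hstar]
    simp [hb0]

lemma nodePoly_monic {N : ℕ} (ζ : Fin N → ℂ) : (nodePoly ζ).Monic :=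
  monic_prod_of_monic _ _ fun j _ => monic_X_sub_C (ζ j)

lemma nodePoly_natDegree {N : ℕ} (ζ : Fin N → ℂ) : (nodePoly ζ).natDegree = N := by
  rw [nodePoly, natDegree_finsetProd_X_sub_C_eq_card, Finset.card_univ, Fintype.card_fin]

lemma nodePoly_eval_eq_zero_iff {N : ℕ} (ζ : Fin N → ℂ) (z : ℂ) :
    (nodePoly ζ).eval z = 0 ↔ z ∈ Set.range ζ := by
  simp only [nodePoly, eval_prod, eval_sub, eval_X, eval_C, Finset.prod_eq_zero_iff,
    Finset.mem_univ, true_and, sub_eq_zero, Set.mem_range, eq_comm (a := z)]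

lemma norm_nodePoly_eval_zero {N : ℕ} {ζ : Fin N → ℂ} (hζ : ∀ j, ‖ζ j‖ = 1) :
    ‖(nodePoly ζ).eval 0‖ = 1 := by
  simp [nodePoly, eval_prod, hζ]

/-- A CMV matrix has the simple spectrum `{ζ_j}` exactly if `Φ_N = ∏ (z - ζ_j)`. -/
lemma spectrum_cmv_eq_range_iff (γ : ℕ → ℂ) (N : ℕ) (hγ : ∀ j < N, ‖γ j‖ ≤ 1) (hb : ‖γ N‖ = 1)
    {ζ : Fin (N + 1) → ℂ} (hζ : Function.Injective ζ) :
    spectrum ℂ (cmvL γ (N + 1) * cmvM γ (N + 1)) = Set.range ζ ↔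
      szego γ (N + 1) = nodePoly ζ := by
  rw [spectrum_cmv γ N hγ hb]
  constructor
  · intro h
    have hd1 : (szego γ (N + 1)).degree = (N + 1 : ℕ) := by
      rw [degree_eq_natDegree (szego_monic _ _).ne_zero, szego_natDegree]
    have hd2 : (nodePoly ζ).degree = (N + 1 : ℕ) := by
      rw [degree_eq_natDegree (nodePoly_monic _).ne_zero, nodePoly_natDegree]
    refine eq_of_degree_le_of_eval_index_eq Finset.univ (v := ζ) hζ.injOn ?_ ?_ ?_ ?_
    · simp [hd1]
    · rw [hd1, hd2]
    · rw [(szego_monic _ _).leadingCoeff, (nodePoly_monic _).leadingCoeff]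
    · intro i _
      rw [(nodePoly_eval_eq_zero_iff ζ _).mpr ⟨i, rfl⟩]
      exact (Set.ext_iff.mp h (ζ i)).mpr ⟨i, rfl⟩
  · intro h
    ext z
    rw [h, Set.mem_ofPred_eq, nodePoly_eval_eq_zero_iff]

/-- The two-spectra problem in terms of the Szegő recursion. -/
lemma isTwoSpectraSolution_iff {m n : ℕ} (hmn : m + 1 < n + 1) {ζ : Fin (n + 1) → ℂ}
    {ξ : Fin (m + 1) → ℂ} (hζ : Function.Injective ζ) (hξ : Function.Injective ξ)
    (α : Fin (n + 1 - 1) → ℂ) (bn bm : ℂ) (a : ℕ → ℂ) (ha : ∀ k : Fin (n + 1 - 1), a k = α k) :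
    IsTwoSpectraSolution hmn (Set.range ζ) (Set.range ξ) α bn bm ↔
      (∀ k < n, ‖a k‖ < 1) ∧ ‖bn‖ = 1 ∧ ‖bm‖ = 1 ∧
      X * szego a n - C (conj bn) * szegoStar a n = nodePoly ζ ∧
      X * szego a m - C (conj bm) * szegoStar a m = nodePoly ξ := by
  have hγn : ∀ j < n, cmvParams (N := n + 1) α bn j = a j := fun j hj => by
    simp [cmvParams, hj, ← ha]
  have hγnn : cmvParams (N := n + 1) α bn n = bn := by simp [cmvParams]
  have hα : (∀ j, ‖α j‖ < 1) ↔ ∀ k < n, ‖a k‖ < 1 := by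
    constructor
    · intro h k hk
      have := ha ⟨k, by simpa using hk⟩
      simp only at this
      rw [this]; exact h _
    · intro h k
      rw [← ha]; exact h _ (by have := k.2; omega)
  set β : Fin (m + 1 - 1) → ℂ :=
    fun j => α (Fin.castLE (Nat.sub_le_sub_right hmn.le 1) j) with hβ
  have hγm : ∀ j < m, cmvParams (N := m + 1) β bm j = a j := fun j hj => by
    simp [cmvParams, hj, hβ, ← ha]
  have hγmm : cmvParams (N := m + 1) β bm m = bm := by simp [cmvParams]
  have key : (∀ k < n, ‖a k‖ < 1) → ‖bn‖ = 1 → ‖bm‖ = 1 →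
      ((spectrum ℂ (cmvMatrix (N := n + 1) α bn) = Set.range ζ ↔
        X * szego a n - C (conj bn) * szegoStar a n = nodePoly ζ) ∧
      (spectrum ℂ (cmvMatrix (N := m + 1) β bm) = Set.range ξ ↔
        X * szego a m - C (conj bm) * szegoStar a m = nodePoly ξ)) := by
    intro h1 h2 h3
    rw [cmvMatrix, cmvMatrix, spectrum_cmv_eq_range_iff _ _ _ _ hζ,
      spectrum_cmv_eq_range_iff _ _ _ _ hξ, szego_succ, szego_succ, hγnn, hγmm,
      szego_congr hγn, szego_congr hγm, szegoStar_congr hγn, szegoStar_congr hγm]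
    · exact ⟨Iff.rfl, Iff.rfl⟩
    · intro j hj; rw [hγm j hj]; exact (h1 j (by omega)).le
    · rwa [hγmm]
    · intro j hj; rw [hγn j hj]; exact (h1 j hj).le
    · rwa [hγnn]
  constructor
  · rintro ⟨h1, h2, h3, h4, h5⟩
    obtain ⟨k1, k2⟩ := key (hα.mp h1) h2 h3
    exact ⟨hα.mp h1, h2, h3, k1.mp h4, k2.mp h5⟩
  · rintro ⟨h1, h2, h3, h4, h5⟩
    obtain ⟨k1, k2⟩ := key h1 h2 h3
    exact ⟨hα.mpr h1, h2, h3, k1.mpr h4, k2.mpr h5⟩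

/-! ### The sesquilinear form of a measure on the nodes -/

/-- The sesquilinear form `⟨P, Q⟩ = ∑_j ω_j P(ζ_j) conj Q(ζ_j)` of the measure `∑_j ω_j δ_{ζ_j}`. -/
noncomputable def nodeForm {n : ℕ} (ω : Fin n → ℝ) (ζ : Fin n → ℂ) (P Q : ℂ[X]) : ℂ :=
  ∑ j, (ω j : ℂ) * P.eval (ζ j) * conj (Q.eval (ζ j))

section nodeForm

variable {n : ℕ} (ω : Fin n → ℝ) (ζ : Fin n → ℂ)

lemma nodeForm_add_left (P P' Q : ℂ[X]) :
    nodeForm ω ζ (P + P') Q = nodeForm ω ζ P Q + nodeForm ω ζ P' Q := by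
  simp only [nodeForm, ← Finset.sum_add_distrib, eval_add]
  exact Finset.sum_congr rfl fun j _ => by ring

lemma nodeForm_sub_left (P P' Q : ℂ[X]) :
    nodeForm ω ζ (P - P') Q = nodeForm ω ζ P Q - nodeForm ω ζ P' Q := by
  simp only [nodeForm, ← Finset.sum_sub_distrib, eval_sub]
  exact Finset.sum_congr rfl fun j _ => by ring

lemma nodeForm_C_mul_left (c : ℂ) (P Q : ℂ[X]) :
    nodeForm ω ζ (C c * P) Q = c * nodeForm ω ζ P Q := by
  simp only [nodeForm, Finset.mul_sum, eval_mul, eval_C]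
  exact Finset.sum_congr rfl fun j _ => by ring

lemma conj_nodeForm (P Q : ℂ[X]) : conj (nodeForm ω ζ P Q) = nodeForm ω ζ Q P := by
  simp only [nodeForm, map_sum, map_mul, Complex.conj_conj, Complex.conj_ofReal]
  exact Finset.sum_congr rfl fun j _ => by ring

lemma nodeForm_add_right (P Q Q' : ℂ[X]) :
    nodeForm ω ζ P (Q + Q') = nodeForm ω ζ P Q + nodeForm ω ζ P Q' := by
  rw [← conj_nodeForm, nodeForm_add_left, map_add, conj_nodeForm, conj_nodeForm]

lemma nodeForm_sub_right (P Q Q' : ℂ[X]) :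
    nodeForm ω ζ P (Q - Q') = nodeForm ω ζ P Q - nodeForm ω ζ P Q' := by
  rw [← conj_nodeForm, nodeForm_sub_left, map_sub, conj_nodeForm, conj_nodeForm]

lemma nodeForm_C_mul_right (c : ℂ) (P Q : ℂ[X]) :
    nodeForm ω ζ P (C c * Q) = conj c * nodeForm ω ζ P Q := by
  rw [← conj_nodeForm, nodeForm_C_mul_left, map_mul, conj_nodeForm]

/-- A polynomial orthogonal to `X^i` for all `i` in the support of `Q` is orthogonal to `Q`. -/
lemma nodeForm_eq_zero_of_support {P Q : ℂ[X]}
    (h : ∀ i, Q.coeff i ≠ 0 → nodeForm ω ζ P (X ^ i) = 0) : nodeForm ω ζ P Q = 0 := by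
  have : nodeForm ω ζ P Q = ∑ i ∈ Q.support, conj (Q.coeff i) * nodeForm ω ζ P (X ^ i) := by
    simp only [nodeForm, Finset.mul_sum]
    rw [Finset.sum_comm]
    refine Finset.sum_congr rfl fun j _ => ?_
    rw [eval_eq_sum (p := Q), Polynomial.sum, map_sum, Finset.mul_sum]
    refine Finset.sum_congr rfl fun i _ => ?_
    simp; ring
  rw [this]
  exact Finset.sum_eq_zero fun i hi => by rw [h i (mem_support_iff.mp hi), mul_zero]

lemma nodeForm_eq_zero_of_degree_lt {P Q : ℂ[X]} {k : ℕ}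
    (h : ∀ i < k, nodeForm ω ζ P (X ^ i) = 0) (hQ : Q.degree < k) : nodeForm ω ζ P Q = 0 :=
  nodeForm_eq_zero_of_support ω ζ fun i hi => h i <| by
    by_contra hik
    exact hi (coeff_eq_zero_of_degree_lt (hQ.trans_le (by exact_mod_cast not_lt.mp hik)))

lemma nodeForm_self (P : ℂ[X]) :
    nodeForm ω ζ P P = ((∑ j, ω j * ‖P.eval (ζ j)‖ ^ 2 : ℝ) : ℂ) := by
  rw [nodeForm]
  push_cast
  refine Finset.sum_congr rfl fun j _ => ?_
  rw [mul_assoc, Complex.mul_conj, Complex.normSq_eq_norm_sq]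
  push_cast; ring

variable {ω ζ}

lemma nodeForm_self_pos (hω : ∀ j, 0 < ω j) (hinj : Function.Injective ζ) {P : ℂ[X]}
    (hP : P ≠ 0) (hd : P.degree < n) : 0 < (nodeForm ω ζ P P).re := by
  rw [nodeForm_self, Complex.ofReal_re]
  have hex : ∃ j, P.eval (ζ j) ≠ 0 := by
    by_contra! h
    exact hP (eq_zero_of_degree_lt_of_eval_index_eq_zero (s := Finset.univ) (v := ζ)
      hinj.injOn      (by simpa using hd) fun j _ => h j)
  obtain ⟨j, hj⟩ := hex
  refine Finset.sum_pos' (fun i _ => mul_nonneg (hω i).le (sq_nonneg _)) ⟨j, Finset.mem_univ _, ?_⟩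
  exact mul_pos (hω j) (pow_pos (norm_pos_iff.mpr hj) 2)

lemma nodeForm_self_eq_zero (hω : ∀ j, 0 < ω j) (hinj : Function.Injective ζ) {P : ℂ[X]}
    (hd : P.degree < n) (h : nodeForm ω ζ P P = 0) : P = 0 := by
  by_contra hP
  have := nodeForm_self_pos hω hinj hP hd
  rw [h] at this
  exact lt_irrefl _ this

/-- Multiplication by `z` is isometric, because the nodes lie on the unit circle. -/
lemma nodeForm_X_mul_X_mul (hζ : ∀ j, ‖ζ j‖ = 1) (P Q : ℂ[X]) :
    nodeForm ω ζ (X * P) (X * Q) = nodeForm ω ζ P Q := by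
  simp only [nodeForm]
  refine Finset.sum_congr rfl fun j _ => ?_
  have := mul_conj_of_norm_one (hζ j)
  simp only [eval_mul, eval_X, map_mul]
  linear_combination (ω j * eval (ζ j) P * conj (eval (ζ j) Q)) * this

/-- The duality `⟨Φ_k^*, z^i⟩ = conj ⟨Φ_k, z^{k-i}⟩`, here for `k = i + l`. -/
lemma nodeForm_szegoStar (hζ : ∀ j, ‖ζ j‖ = 1) (a : ℕ → ℂ) {k i l : ℕ} (hk : k = i + l) :
    nodeForm ω ζ (szegoStar a k) (X ^ i) = conj (nodeForm ω ζ (szego a k) (X ^ l)) := by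
  simp only [nodeForm, map_sum]
  refine Finset.sum_congr rfl fun j _ => ?_
  have h1 := mul_conj_of_norm_one (hζ j)
  have h2 : ζ j ^ i * conj (ζ j) ^ i = 1 := by rw [← mul_pow, h1, one_pow]
  rw [szegoStar_eval a k (hζ j), hk, pow_add]
  simp only [eval_pow, eval_X, map_mul, map_pow, Complex.conj_conj, Complex.conj_ofReal]
  linear_combination (ω j * ζ j ^ l * conj (eval (ζ j) (szego a (i + l)))) * h2

/-! ### Orthogonality and the Szegő recursion -/

/-- The polynomials of the Szegő recursion with coefficients `a` are, up to degree `n - 1`,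
the monic orthogonal polynomials of the measure `∑_j ω_j δ_{ζ_j}` on `n` nodes. -/
def IsSzegoSeq (ω : Fin n → ℝ) (ζ : Fin n → ℂ) (a : ℕ → ℂ) : Prop :=
  ∀ k < n, ∀ l < k, nodeForm ω ζ (szego a k) (X ^ l) = 0

lemma szego_degree (a : ℕ → ℂ) (k : ℕ) : (szego a k).degree = k := by
  rw [degree_eq_natDegree (szego_monic a k).ne_zero, szego_natDegree]

lemma szegoStar_degree_lt (a : ℕ → ℂ) (k : ℕ) : (szegoStar a k).degree < (k + 1 : ℕ) :=
  degree_le_natDegree.trans_lt <| by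
    exact_mod_cast (szegoStar_natDegree_le a k).trans_lt k.lt_succ_self

lemma degree_sub_lt_of_monic {P Q : ℂ[X]} {k : ℕ} (hP : P.Monic) (hQ : Q.Monic)
    (hPk : P.natDegree = k) (hQk : Q.natDegree = k) : (P - Q).degree < k := by
  have h1 : P.degree = k := by rw [degree_eq_natDegree hP.ne_zero, hPk]
  have h2 : Q.degree = k := by rw [degree_eq_natDegree hQ.ne_zero, hQk]
  rw [← h1]
  exact degree_sub_lt_left (by rw [h1, h2]) hP.ne_zero (by rw [hP.leadingCoeff, hQ.leadingCoeff])

namespace IsSzegoSeq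

variable {a : ℕ → ℂ}

lemma nodeForm_eq_zero (h : IsSzegoSeq ω ζ a) {k : ℕ} (hk : k < n) {Q : ℂ[X]}
    (hQ : Q.degree < k) : nodeForm ω ζ (szego a k) Q = 0 :=
  nodeForm_eq_zero_of_degree_lt ω ζ (h k hk) hQ

/-- `Φ_k^*` is orthogonal to `z, …, z^k`. -/
lemma nodeForm_star_eq_zero (h : IsSzegoSeq ω ζ a) (hζ : ∀ j, ‖ζ j‖ = 1) {k i : ℕ} (hk : k < n)
    (hi : 0 < i) (hik : i ≤ k) : nodeForm ω ζ (szegoStar a k) (X ^ i) = 0 := by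
  rw [nodeForm_szegoStar hζ a (show k = i + (k - i) by omega), h k hk _ (by omega), map_zero]

lemma nodeForm_X_pow_self (h : IsSzegoSeq ω ζ a) {k : ℕ} (hk : k < n) :
    nodeForm ω ζ (szego a k) (X ^ k) = nodeForm ω ζ (szego a k) (szego a k) := by
  have := h.nodeForm_eq_zero hk (Q := szego a k - X ^ k) (degree_sub_lt_of_monic
    (szego_monic a k) (monic_X_pow k) (szego_natDegree a k) (natDegree_X_pow k))
  rw [nodeForm_sub_right, sub_eq_zero] at this
  exact this.symm

lemma nodeForm_self_ne_zero (hω : ∀ j, 0 < ω j) (hinj : Function.Injective ζ) (a : ℕ → ℂ)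
    {k : ℕ} (hk : k < n) : nodeForm ω ζ (szego a k) (szego a k) ≠ 0 := fun h =>
  (szego_monic a k).ne_zero (nodeForm_self_eq_zero hω hinj
    (by rw [szego_degree]; exact_mod_cast hk) h)

/-- The recursion `‖Φ_{k+1}‖² = (1 - |a_k|²) ‖Φ_k‖²`. -/
lemma nodeForm_self_succ (h : IsSzegoSeq ω ζ a) (hζ : ∀ j, ‖ζ j‖ = 1) {k : ℕ} (hk : k + 1 < n) :
    nodeForm ω ζ (szego a (k + 1)) (szego a (k + 1)) =
      (1 - a k * conj (a k)) * nodeForm ω ζ (szego a k) (szego a k) := by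
  have h1 := h.nodeForm_eq_zero hk (szegoStar_degree_lt a k)
  have h1' : nodeForm ω ζ (szegoStar a k) (szego a (k + 1)) = 0 := by
    rw [← conj_nodeForm, h1, map_zero]
  have h2 : nodeForm ω ζ (szegoStar a k) (szegoStar a k) =
      nodeForm ω ζ (szego a k) (szego a k) := by
    simp only [nodeForm]
    refine Finset.sum_congr rfl fun j _ => ?_
    have h1 := mul_conj_of_norm_one (hζ j)
    have h2 : ζ j ^ k * conj (ζ j) ^ k = 1 := by rw [← mul_pow, h1, one_pow]
    rw [szegoStar_eval a k (hζ j)]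
    simp only [map_mul, map_pow, Complex.conj_conj]
    linear_combination (ω j * eval (ζ j) (szego a k) * conj (eval (ζ j) (szego a k))) * h2
  have h3 : X * szego a k = szego a (k + 1) + C (conj (a k)) * szegoStar a k := by
    rw [szego_succ]; ring
  have h4 := nodeForm_X_mul_X_mul (ω := ω) hζ (szego a k) (szego a k)
  rw [h3, nodeForm_add_left, nodeForm_add_right, nodeForm_add_right, nodeForm_C_mul_left,
    nodeForm_C_mul_left, nodeForm_C_mul_right, nodeForm_C_mul_right, h1, h1', h2,
    Complex.conj_conj] at h4
  linear_combination h4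

lemma norm_lt_one (h : IsSzegoSeq ω ζ a) (hω : ∀ j, 0 < ω j) (hζ : ∀ j, ‖ζ j‖ = 1)
    (hinj : Function.Injective ζ) {k : ℕ} (hk : k + 1 < n) : ‖a k‖ < 1 := by
  have h1 := congrArg Complex.re (h.nodeForm_self_succ hζ hk)
  have h2 := nodeForm_self_pos hω hinj (szego_monic a (k + 1)).ne_zero
    (by rw [szego_degree]; exact_mod_cast hk)
  have h3 := nodeForm_self_pos hω hinj (szego_monic a k).ne_zero
    (by rw [szego_degree]; exact_mod_cast (k.lt_succ_self.trans hk))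
  rw [Complex.mul_conj, Complex.normSq_eq_norm_sq, ← Complex.ofReal_one, ← Complex.ofReal_sub,
    Complex.re_ofReal_mul] at h1
  rw [h1] at h2
  have h4 := (mul_pos_iff_of_pos_right h3).mp h2
  nlinarith [norm_nonneg (a k)]

/-- Paraorthogonality: a monic polynomial of degree `k + 1` orthogonal to `z, …, z^k` is given by
one step of the Szegő recursion. -/
lemma eq_of_orthogonal (h : IsSzegoSeq ω ζ a) (hω : ∀ j, 0 < ω j) (hζ : ∀ j, ‖ζ j‖ = 1)
    (hinj : Function.Injective ζ) {k : ℕ} (hk : k < n) {P : ℂ[X]} (hP : P.Monic)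
    (hPk : P.natDegree = k + 1)
    (horth : ∀ i, 1 ≤ i → i ≤ k → nodeForm ω ζ P (X ^ i) = 0) :
    P = X * szego a k + C (P.eval 0) * szegoStar a k := by
  -- the difference is `X * R` with `deg R < k`, and `R` is orthogonal to all degrees below `k`
  set Q := P - X * szego a k - C (P.eval 0) * szegoStar a k with hQ
  have hQ0 : Q.coeff 0 = 0 := by
    rw [coeff_zero_eq_eval_zero, hQ]
    simp [szegoStar_eval_zero]
  obtain ⟨R, hR⟩ := X_dvd_iff.mpr hQ0
  have hQd : Q.degree < (k + 1 : ℕ) := by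
    refine (degree_sub_le _ _).trans_lt (max_lt ?_ ?_)
    · exact degree_sub_lt_of_monic hP (monic_X.mul (szego_monic a k)) hPk
        (by rw [natDegree_X_mul (szego_monic a k).ne_zero, szego_natDegree])
    · refine lt_of_le_of_lt ?_ (szegoStar_degree_lt a k)
      rw [C_mul']
      exact degree_smul_le _ _
  have hRd : R.degree < k := by
    rw [hR, degree_mul, degree_X, add_comm] at hQd
    push_cast at hQd
    exact lt_of_add_lt_add_right hQd
  have hRR : nodeForm ω ζ R R = 0 := by
    refine nodeForm_eq_zero_of_degree_lt ω ζ (k := k) (fun i hi => ?_) hRd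
    rw [← nodeForm_X_mul_X_mul hζ, ← hR, hQ, ← pow_succ', nodeForm_sub_left, nodeForm_sub_left,
      nodeForm_C_mul_left, horth _ (by omega) (by omega),
      h.nodeForm_star_eq_zero hζ hk (by omega) (by omega), pow_succ', nodeForm_X_mul_X_mul hζ,
      h k hk i hi]
    ring
  have hR0 := nodeForm_self_eq_zero hω hinj
    (hRd.trans (by exact_mod_cast hk)) hRR
  rw [hR0, mul_zero, hQ] at hR
  linear_combination hR

/-- The converse of `IsSzegoSeq.eq_of_orthogonal`. -/
lemma orthogonal_of_eq (h : IsSzegoSeq ω ζ a) (hζ : ∀ j, ‖ζ j‖ = 1) {k i : ℕ} (hk : k < n)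
    (c : ℂ) (hi : 1 ≤ i) (hik : i ≤ k) :
    nodeForm ω ζ (X * szego a k - C c * szegoStar a k) (X ^ i) = 0 := by
  obtain ⟨l, rfl⟩ : ∃ l, i = l + 1 := ⟨i - 1, by omega⟩
  rw [nodeForm_sub_left, nodeForm_C_mul_left, h.nodeForm_star_eq_zero hζ hk hi hik, pow_succ',
    nodeForm_X_mul_X_mul hζ, h k hk l (by omega)]
  ring

/-- A monic polynomial of degree `k < n` orthogonal to all lower degrees is `Φ_k`. -/
lemma eq_szego (h : IsSzegoSeq ω ζ a) (hω : ∀ j, 0 < ω j) (hinj : Function.Injective ζ)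
    {k : ℕ} (hk : k < n) {P : ℂ[X]} (hP : P.Monic) (hPk : P.natDegree = k)
    (horth : ∀ i < k, nodeForm ω ζ P (X ^ i) = 0) : P = szego a k := by
  have hd := degree_sub_lt_of_monic hP (szego_monic a k) hPk (szego_natDegree a k)
  have h1 : nodeForm ω ζ (P - szego a k) (P - szego a k) = 0 := by
    rw [nodeForm_sub_left, h.nodeForm_eq_zero hk hd, nodeForm_eq_zero_of_degree_lt ω ζ horth hd,
      sub_zero]
  exact sub_eq_zero.mp (nodeForm_self_eq_zero hω hinj (hd.trans (by exact_mod_cast hk)) h1)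

end IsSzegoSeq

/-- The pairs `(Φ_k, Φ_k^*)` of a measure on the nodes, with the recursion coefficient chosen so
that `Φ_{k+1}` becomes orthogonal to `1`. -/
noncomputable def opucPair (ω : Fin n → ℝ) (ζ : Fin n → ℂ) : ℕ → ℂ[X] × ℂ[X]
  | 0 => (1, 1)
  | k + 1 =>
    let p := opucPair ω ζ k
    let c := nodeForm ω ζ (X * p.1) 1 / nodeForm ω ζ p.2 1
    (X * p.1 - C c * p.2, p.2 - C (conj c) * (X * p.1))

/-- The Verblunsky coefficients of a measure on the nodes, from the orthogonality of `Φ_{k+1}`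
to `1`. -/
noncomputable def nodeVerblunsky (ω : Fin n → ℝ) (ζ : Fin n → ℂ) (k : ℕ) : ℂ :=
  conj (nodeForm ω ζ (X * (opucPair ω ζ k).1) 1 / nodeForm ω ζ (opucPair ω ζ k).2 1)

lemma szegoPair_nodeVerblunsky (ω : Fin n → ℝ) (ζ : Fin n → ℂ) (k : ℕ) :
    szegoPair (nodeVerblunsky ω ζ) k = opucPair ω ζ k := by
  induction k with
  | zero => rfl
  | succ k ih => simp only [szegoPair, opucPair, ih, nodeVerblunsky, Complex.conj_conj]

lemma isSzegoSeq_nodeVerblunsky (hω : ∀ j, 0 < ω j) (hζ : ∀ j, ‖ζ j‖ = 1)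
    (hinj : Function.Injective ζ) : IsSzegoSeq ω ζ (nodeVerblunsky ω ζ) := by
  set a := nodeVerblunsky ω ζ with ha
  have hak : ∀ k, conj (a k) =
      nodeForm ω ζ (X * szego a k) 1 / nodeForm ω ζ (szegoStar a k) 1 := fun k => by
    rw [szego, szegoStar, ha, szegoPair_nodeVerblunsky, nodeVerblunsky, Complex.conj_conj]
  intro k
  induction k with
  | zero => intro _ l hl; omega
  | succ k ih =>
    intro hk l hl
    have hk' : k < n := by omega
    have hko := ih hk'
    have hstar : ∀ i l, k = i + l → 0 < i → nodeForm ω ζ (szegoStar a k) (X ^ i) = 0 := by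
      intro i l h hi
      rw [nodeForm_szegoStar hζ a h, hko l (by omega), map_zero]
    rw [szego_succ, nodeForm_sub_left, nodeForm_C_mul_left]
    rcases l with _ | l
    · have h0 : nodeForm ω ζ (szegoStar a k) 1 ≠ 0 := by
        have h1 := nodeForm_szegoStar (ω := ω) hζ a (zero_add k).symm
        have h2 := nodeForm_eq_zero_of_degree_lt ω ζ hko (Q := szego a k - X ^ k)
          (degree_sub_lt_of_monic (szego_monic a k) (monic_X_pow k) (szego_natDegree a k)
            (natDegree_X_pow k))
        rw [nodeForm_sub_right, sub_eq_zero] at h2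
        rw [pow_zero, ← h2, conj_nodeForm] at h1
        rw [h1]
        exact IsSzegoSeq.nodeForm_self_ne_zero hω hinj a hk'
      rw [pow_zero, hak, div_mul_cancel₀ _ h0, sub_self]
    · rw [hstar (l + 1) (k - (l + 1)) (by omega) (by omega), pow_succ', nodeForm_X_mul_X_mul hζ,
        hko l (by omega)]
      ring

end nodeForm

/-! ### Christoffel weights -/

/-- The normalization `‖Φ_k‖² = ∏_{j < k} (1 - |a_j|²)`. -/
noncomputable def szegoNormSq (a : ℕ → ℂ) (k : ℕ) : ℝ := ∏ j ∈ Finset.range k, (1 - ‖a j‖ ^ 2)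

lemma szegoNormSq_pos {a : ℕ → ℂ} {k : ℕ} (ha : ∀ j < k, ‖a j‖ < 1) : 0 < szegoNormSq a k :=
  Finset.prod_pos fun j hj => by
    have := ha j (Finset.mem_range.mp hj)
    nlinarith [norm_nonneg (a j)]

/-- The Christoffel–Darboux formula for the Szegő recursion. -/
lemma christoffel_darboux (a : ℕ → ℂ) (k : ℕ) (ha : ∀ j < k, ‖a j‖ < 1) (z w : ℂ) :
    (1 - z * conj w) * ∑ l ∈ Finset.range (k + 1),
        (szego a l).eval z * conj ((szego a l).eval w) / szegoNormSq a l =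
      ((szegoStar a k).eval z * conj ((szegoStar a k).eval w) -
        z * conj w * ((szego a k).eval z * conj ((szego a k).eval w))) / szegoNormSq a k := by
  induction k with
  | zero => simp [szegoNormSq]
  | succ k ih =>
    have h0 : (szegoNormSq a k : ℂ) ≠ 0 := by
      exact_mod_cast (szegoNormSq_pos fun j hj => ha j (by omega)).ne'
    have h1 : (szegoNormSq a (k + 1) : ℂ) ≠ 0 := by
      exact_mod_cast (szegoNormSq_pos ha).ne'
    have h2 : (szegoNormSq a (k + 1) : ℂ) = szegoNormSq a k * (1 - a k * conj (a k)) := by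
      rw [szegoNormSq, Finset.prod_range_succ, Complex.mul_conj, Complex.normSq_eq_norm_sq]
      push_cast [szegoNormSq]; ring
    have h3 : (1 - a k * conj (a k)) ≠ 0 := fun h => h1 (by rw [h2, h, mul_zero])
    rw [Finset.sum_range_succ, mul_add, ih fun j hj => ha j (by omega), h2]
    simp only [szego_succ, szegoStar_succ, eval_sub, eval_mul, eval_C, eval_X, map_sub, map_mul,
      Complex.conj_conj]
    generalize hr : 1 - a k * conj (a k) = r at h3
    field_simp
    linear_combination (-((szegoStar a k).eval z * conj ((szegoStar a k).eval w) -
      z * conj w * ((szego a k).eval z * conj ((szego a k).eval w)))) * hr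

/-- The Christoffel weights `1 / ∑_{k < n} |Φ_k (ζ_j)|² / ‖Φ_k‖²`. -/
noncomputable def christoffelWeight {n : ℕ} (a : ℕ → ℂ) (ζ : Fin n → ℂ) (j : Fin n) : ℝ :=
  (∑ k ∈ Finset.range n, ‖(szego a k).eval (ζ j)‖ ^ 2 / szegoNormSq a k)⁻¹

section

variable {n : ℕ} {a : ℕ → ℂ} {ζ : Fin (n + 1) → ℂ}

lemma christoffel_sum_pos (ha : ∀ k < n, ‖a k‖ < 1) (j : Fin (n + 1)) :
    0 < ∑ k ∈ Finset.range (n + 1), ‖(szego a k).eval (ζ j)‖ ^ 2 / szegoNormSq a k := by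
  refine Finset.sum_pos' (fun k hk => div_nonneg (sq_nonneg _)
    (szegoNormSq_pos fun i hi => ha i ?_).le) ⟨0, by simp, by simp [szegoNormSq]⟩
  have := Finset.mem_range.mp hk
  omega

lemma christoffelWeight_pos (ha : ∀ k < n, ‖a k‖ < 1) (j : Fin (n + 1)) :
    0 < christoffelWeight a ζ j := inv_pos.mpr (christoffel_sum_pos ha j)

/-- If the nodes are the zeros of a paraorthogonal polynomial `z Φ_n - conj b Φ_n^*`, then the
Christoffel weights make the `Φ_k` orthogonal: by the Christoffel–Darboux formula the matrix
`√ω_j Φ_k (ζ_j) / ‖Φ_k‖` has orthonormal columns, hence orthonormal rows. -/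
lemma isSzegoSeq_christoffelWeight (ha : ∀ k < n, ‖a k‖ < 1) (hζ : ∀ j, ‖ζ j‖ = 1)
    (hinj : Function.Injective ζ) {b : ℂ} (hb : ‖b‖ = 1)
    (h : X * szego a n - C (conj b) * szegoStar a n = nodePoly ζ) :
    IsSzegoSeq (christoffelWeight a ζ) ζ a := by
  have hpos : ∀ k < n + 1, (0 : ℝ) < szegoNormSq a k := fun k hk =>
    szegoNormSq_pos fun j hj => ha j (by omega)
  set ω := christoffelWeight a ζ with hω
  let U : Matrix (Fin (n + 1)) (Fin (n + 1)) ℂ :=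
    Matrix.of fun i k => ω i * (szego a k).eval (ζ i)
  let V : Matrix (Fin (n + 1)) (Fin (n + 1)) ℂ :=
    Matrix.of fun k j => conj ((szego a k).eval (ζ j)) / szegoNormSq a k
  have hUV : U * V = 1 := by
    ext i j
    rw [Matrix.mul_apply]
    have e : ∑ k, U i k * V k j = ω i * ∑ l ∈ Finset.range (n + 1),
        (szego a l).eval (ζ i) * conj ((szego a l).eval (ζ j)) / szegoNormSq a l := by
      rw [Finset.sum_range, Finset.mul_sum]
      exact Finset.sum_congr rfl fun k _ => by simp only [U, V, Matrix.of_apply]; ring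
    rw [e]
    by_cases hij : i = j
    · subst hij
      rw [Matrix.one_apply_eq]
      have : ∑ l ∈ Finset.range (n + 1),
          (szego a l).eval (ζ i) * conj ((szego a l).eval (ζ i)) / szegoNormSq a l =
          ((ω i)⁻¹ : ℝ) := by
        rw [hω, christoffelWeight, inv_inv]
        push_cast
        refine Finset.sum_congr rfl fun k _ => ?_
        rw [Complex.mul_conj, Complex.normSq_eq_norm_sq]
        push_cast; ring
      rw [this, ← Complex.ofReal_mul, mul_inv_cancel₀ (christoffelWeight_pos ha i).ne']
      simp
    · rw [Matrix.one_apply_ne hij]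
      have hne : (1 - ζ i * conj (ζ j)) ≠ 0 := by
        intro h0
        have := mul_conj_of_norm_one (hζ j)
        apply hij (hinj _)
        linear_combination (-ζ j) * h0 - ζ i * this
      have hcd := christoffel_darboux a n ha (ζ i) (ζ j)
      have hz : ∀ l, ζ l * (szego a n).eval (ζ l) = conj b * (szegoStar a n).eval (ζ l) := by
        intro l
        have := congrArg (eval (ζ l)) h
        rw [(nodePoly_eval_eq_zero_iff ζ _).mpr ⟨l, rfl⟩] at this
        simp only [eval_sub, eval_mul, eval_X, eval_C] at this
        exact sub_eq_zero.mp this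
      have hzero : (szegoStar a n).eval (ζ i) * conj ((szegoStar a n).eval (ζ j)) -
          ζ i * conj (ζ j) * ((szego a n).eval (ζ i) * conj ((szego a n).eval (ζ j))) = 0 := by
        have h1 := hz i
        have h2 := congrArg conj (hz j)
        simp only [map_mul, Complex.conj_conj] at h2
        have h3 := mul_conj_of_norm_one hb
        linear_combination (-conj (ζ j) * conj ((szego a n).eval (ζ j))) * h1 -
          (conj b * (szegoStar a n).eval (ζ i)) * h2 -
          ((szegoStar a n).eval (ζ i) * conj ((szegoStar a n).eval (ζ j))) * h3
      rw [hzero, zero_div] at hcd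
      rw [(mul_eq_zero.mp hcd).resolve_left hne, mul_zero]
  have hVU : V * U = 1 := mul_eq_one_comm.mp hUV
  have horth : ∀ k l, l < k → k < n + 1 → nodeForm ω ζ (szego a k) (szego a l) = 0 := by
    intro k l hlk hk
    have h1 := congrFun (congrFun hVU ⟨l, hlk.trans hk⟩) ⟨k, hk⟩
    rw [Matrix.mul_apply, Matrix.one_apply_ne (by simp [Fin.ext_iff]; omega)] at h1
    have h2 : (szegoNormSq a l : ℂ) ≠ 0 := by exact_mod_cast (hpos l (by omega)).ne'
    have h3 : nodeForm ω ζ (szego a k) (szego a l) = szegoNormSq a l * 0 := by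
      rw [← h1, Finset.mul_sum]
      refine Finset.sum_congr rfl fun j _ => ?_
      simp only [U, V, Matrix.of_apply]
      field_simp
    rw [h3, mul_zero]
  intro k hk l
  -- `X ^ l` differs from `Φ_l` by a polynomial of lower degree
  induction l using Nat.strong_induction_on with
  | _ l ih =>
    intro hl
    have h1 := horth k l hl hk
    have h2 : nodeForm ω ζ (szego a k) (X ^ l - szego a l) = 0 :=
      nodeForm_eq_zero_of_degree_lt ω ζ (fun i hi => ih i hi (hi.trans hl))
        (degree_sub_lt_of_monic (monic_X_pow l) (szego_monic a l) (natDegree_X_pow l)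
          (szego_natDegree a l))
    rwa [nodeForm_sub_right, h1, sub_zero] at h2

end

section

variable {n : ℕ} {ω ω' : Fin n → ℝ} {ζ : Fin n → ℂ} {a : ℕ → ℂ}

/-- The orthogonal polynomials up to degree `n - 1` determine the weights on `n` nodes up to a
common factor. -/
lemma IsSzegoSeq.proportional (h : IsSzegoSeq ω ζ a) (h' : IsSzegoSeq ω' ζ a)
    (hω : ∀ j, 0 < ω j) (hinj : Function.Injective ζ) :
    ∃ c : ℝ, ∀ j, ω' j = c * ω j := by
  rcases Nat.eq_zero_or_pos n with rfl | hn
  · exact ⟨0, fun j => j.elim0⟩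
  -- the factor `c` makes `ω' - c ω` a functional that vanishes at `Φ_0 = 1`, hence at all `Φ_k`
  have hs : 0 < ∑ j, ω j := Finset.sum_pos (fun j _ => hω j) ⟨⟨0, hn⟩, Finset.mem_univ _⟩
  set c := (∑ j, ω' j) / ∑ j, ω j with hc
  set x : Fin n → ℝ := fun j => ω' j - c * ω j with hx
  have hlin : ∀ P Q, nodeForm x ζ P Q = nodeForm ω' ζ P Q - c * nodeForm ω ζ P Q := by
    intro P Q
    simp only [nodeForm, hx, Finset.mul_sum, ← Finset.sum_sub_distrib]
    exact Finset.sum_congr rfl fun j _ => by push_cast; ring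
  have hΦ : ∀ k < n, nodeForm x ζ (szego a k) 1 = 0 := by
    intro k hk
    rcases Nat.eq_zero_or_pos k with rfl | hk0
    · have h1 : ∀ ω : Fin n → ℝ, nodeForm ω ζ 1 1 = ((∑ j, ω j : ℝ) : ℂ) := fun ω => by
        simp [nodeForm]
      rw [szego_zero, hlin, h1, h1, ← Complex.ofReal_mul, hc, div_mul_cancel₀ _ hs.ne', sub_self]
    · rw [hlin, ← pow_zero X, h k hk 0 hk0, h' k hk 0 hk0]; simp
  have hX : ∀ k < n, nodeForm x ζ 1 (X ^ k) = 0 := by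
    intro k
    induction k using Nat.strong_induction_on with
    | _ k ih =>
      intro hk
      have h1 : nodeForm x ζ 1 (szego a k) = 0 := by
        rw [← conj_nodeForm, hΦ k hk, map_zero]
      have h2 : nodeForm x ζ 1 (X ^ k - szego a k) = 0 :=
        nodeForm_eq_zero_of_degree_lt x ζ (fun i hi => ih i hi (hi.trans hk))
          (degree_sub_lt_of_monic (monic_X_pow k) (szego_monic a k) (natDegree_X_pow k)
            (szego_natDegree a k))
      rwa [nodeForm_sub_right, h1, sub_zero] at h2
  refine ⟨c, fun j => ?_⟩
  have hb := nodeForm_eq_zero_of_degree_lt x ζ hX (Q := Lagrange.basis Finset.univ ζ j) (by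
    rw [Lagrange.degree_basis hinj.injOn (Finset.mem_univ j)]
    simp only [Finset.card_univ, Fintype.card_fin]
    exact_mod_cast Nat.sub_lt hn one_pos)
  rw [nodeForm, Finset.sum_eq_single j, Lagrange.eval_basis_self hinj.injOn (Finset.mem_univ j)]
    at hb
  · simp only [eval_one, mul_one, map_one, Complex.ofReal_eq_zero, hx] at hb
    linarith
  · intro i _ hij
    rw [Lagrange.eval_basis_of_ne hij.symm (Finset.mem_univ i), map_zero, mul_zero]
  · simp

/-! ### Integrals against the node measure -/

lemma integral_nodeMeasure (hω : ∀ j, 0 ≤ ω j) (ζ : Fin n → ℂ) (f : ℂ → ℂ) :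
    ∫ z, f z ∂(nodeMeasure ω ζ) = ∑ j, (ω j : ℂ) * f (ζ j) := by
  rw [nodeMeasure, integral_finsetSum_measure]
  · refine Finset.sum_congr rfl fun j _ => ?_
    rw [integral_smul_measure, integral_dirac, ENNReal.toReal_ofReal (hω j), Complex.real_smul]
  · intro j _
    exact (integrable_dirac (by simp)).smul_measure ENNReal.ofReal_ne_top

lemma integral_eval_mul_conj_pow (hω : ∀ j, 0 ≤ ω j) (ζ : Fin n → ℂ) (P : ℂ[X]) (l : ℕ) :
    ∫ z, P.eval z * conj (z ^ l) ∂(nodeMeasure ω ζ) = nodeForm ω ζ P (X ^ l) := by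
  rw [integral_nodeMeasure hω, nodeForm]
  exact Finset.sum_congr rfl fun j _ => by rw [eval_pow, eval_X, mul_assoc]

lemma zpow_neg_eq_conj_pow {z : ℂ} (hz : ‖z‖ = 1) (k : ℕ) : z ^ (-(k : ℤ)) = conj (z ^ k) := by
  have h : z ^ k * conj (z ^ k) = 1 := mul_conj_of_norm_one (by rw [norm_pow, hz, one_pow])
  rw [zpow_neg, zpow_natCast]
  exact (eq_inv_of_mul_eq_one_right h).symm

lemma trigMoment_nodeMeasure (hω : ∀ j, 0 ≤ ω j) (hζ : ∀ j, ‖ζ j‖ = 1) (k : ℕ) :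
    trigMoment (nodeMeasure ω ζ) (-(k : ℤ)) = nodeForm ω ζ 1 (X ^ k) := by
  rw [trigMoment, integral_nodeMeasure hω, nodeForm]
  refine Finset.sum_congr rfl fun j _ => ?_
  rw [zpow_neg_eq_conj_pow (hζ j)]
  simp

/-- The Verblunsky coefficients of a measure on the nodes are unique, and are the coefficients of
the Szegő recursion. -/
lemma IsSzegoSeq.hasVerblunskyCoeffs_iff (h : IsSzegoSeq ω ζ a) (hω : ∀ j, 0 < ω j)
    (hinj : Function.Injective ζ) (α : Fin (n - 1) → ℂ) :
    HasVerblunskyCoeffs (nodeMeasure ω ζ) α ↔ ∀ k : Fin (n - 1), α k = a k := by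
  have hω' : ∀ j, 0 ≤ ω j := fun j => (hω j).le
  refine forall_congr' fun k => ?_
  have hk : (k : ℕ) + 1 < n := by have := k.2; omega
  constructor
  · rintro ⟨Φ, hΦ, hα⟩
    have : Φ = szego a (k + 1) := h.eq_szego hω hinj hk hΦ.monic hΦ.natDegree_eq fun i hi => by
      rw [← integral_eval_mul_conj_pow hω']
      exact hΦ.orthogonal i hi
    rw [hα, this, szego_succ_eval_zero]
    simp
  · intro hα
    refine ⟨szego a (k + 1), ⟨szego_monic _ _, szego_natDegree _ _, fun l hl => ?_⟩, ?_⟩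
    · rw [integral_eval_mul_conj_pow hω']
      exact h _ hk l hl
    · rw [hα, szego_succ_eval_zero]; simp

/-- The linear system for the weights says that `Ψ_m` is orthogonal to `z, …, z^{m-1}`. -/
lemma mem_positiveWeights_iff {m : ℕ} (hζ : ∀ j, ‖ζ j‖ = 1) (ξ : Fin m → ℂ) :
    ω ∈ positiveWeights ζ ξ ↔ (∀ j, 0 < ω j) ∧
      ∀ k, 1 ≤ k → k + 1 ≤ m → nodeForm ω ζ (nodePoly ξ) (X ^ k) = 0 := by
  refine and_congr_right fun _ => forall_congr' fun k => forall_congr' fun _ =>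
    forall_congr' fun _ => ?_
  rw [nodeForm]
  simp only [zpow_neg_eq_conj_pow (hζ _), eval_pow, eval_X]

end

/-! ### The Schur algorithm -/

section

variable {n : ℕ} {ω : Fin n → ℝ} {ζ : Fin n → ℂ} {a : ℕ → ℂ}

lemma IsSzegoSeq.nodeForm_star_X_pow_succ (h : IsSzegoSeq ω ζ a) (hζ : ∀ j, ‖ζ j‖ = 1) {k : ℕ}
    (hk : k + 1 < n) : nodeForm ω ζ (szegoStar a k) (X ^ (k + 1)) =
      a k * nodeForm ω ζ (szego a k) (szego a k) := by
  have h1 := nodeForm_szegoStar (ω := ω) hζ a (add_zero (k + 1)).symm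
  rw [h (k + 1) hk 0 k.succ_pos, map_zero, szegoStar_succ, nodeForm_sub_left, nodeForm_C_mul_left,
    pow_succ', nodeForm_X_mul_X_mul hζ, h.nodeForm_X_pow_self (k.lt_succ_self.trans hk)] at h1
  rw [pow_succ']
  exact sub_eq_zero.mp h1

/-- The iterates of the Schur algorithm are quotients of two power series whose low-order
coefficients are `⟨Φ_k^*, z^{j+k+1}⟩` and `⟨Φ_k, z^{j+k}⟩`. One step of the Schur algorithm acts on
numerator and denominator in the same way as one step of the Szegő recursion. Each step loses one
known coefficient, so the first `n` terms of `c` suffice for all `k < n`. -/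
lemma IsSzegoSeq.schurIterate_mul_eq (h : IsSzegoSeq ω ζ a) (hω : ∀ j, 0 < ω j)
    (hζ : ∀ j, ‖ζ j‖ = 1) (hinj : Function.Injective ζ) {c : ℕ → ℂ}
    (hc : ∀ j < n, c j = nodeForm ω ζ 1 (X ^ j)) (k : ℕ) (hk : k < n) :
    ∃ A B : PowerSeries ℂ, schurIterate c k * B = A ∧
      (∀ j, j + k < n → PowerSeries.coeff j B = nodeForm ω ζ (szego a k) (X ^ (j + k))) ∧
      ∀ j, j + k + 1 < n →
        PowerSeries.coeff j A = nodeForm ω ζ (szegoStar a k) (X ^ (j + k + 1)) := by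
  induction k with
  | zero =>
    refine ⟨PowerSeries.mk fun j => c (j + 1), PowerSeries.mk c, ?_, fun j hj => ?_,
      fun j hj => ?_⟩
    · have h0 : PowerSeries.constantCoeff (PowerSeries.mk c) ≠ 0 := by
        rw [← PowerSeries.coeff_zero_eq_constantCoeff_apply, PowerSeries.coeff_mk, hc 0 hk,
          pow_zero]
        have := IsSzegoSeq.nodeForm_self_ne_zero hω hinj a hk
        rwa [szego_zero] at this
      rw [schurIterate, mul_assoc, PowerSeries.inv_mul_cancel _ h0, mul_one]
    · rw [PowerSeries.coeff_mk, szego_zero, add_zero, hc j hj]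
    · rw [PowerSeries.coeff_mk, szegoStar_zero, add_zero, hc _ hj]
  | succ k ih =>
    obtain ⟨A, B, hAB, hB, hA⟩ := ih (by omega)
    have hB0 := hB 0 (by omega)
    have hA0 := hA 0 (by omega)
    rw [zero_add, h.nodeForm_X_pow_self (by omega)] at hB0
    rw [zero_add, h.nodeForm_star_X_pow_succ hζ hk] at hA0
    have hh := IsSzegoSeq.nodeForm_self_ne_zero hω hinj a (show k < n by omega)
    set f := schurIterate c k with hf
    have hf0 : PowerSeries.constantCoeff f = a k := by
      have := congrArg PowerSeries.constantCoeff hAB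
      rw [map_mul, ← PowerSeries.coeff_zero_eq_constantCoeff_apply,
        ← PowerSeries.coeff_zero_eq_constantCoeff_apply,
        ← PowerSeries.coeff_zero_eq_constantCoeff_apply, hA0, hB0] at this
      rw [← PowerSeries.coeff_zero_eq_constantCoeff_apply]
      exact mul_right_cancel₀ hh this
    set S : PowerSeries ℂ := PowerSeries.mk fun j => PowerSeries.coeff (j + 1) f with hS
    set A' : PowerSeries ℂ := PowerSeries.mk fun j =>
      PowerSeries.coeff (j + 1) A - a k * PowerSeries.coeff (j + 1) B with hA'
    have hXS : PowerSeries.X * S = f - PowerSeries.C (a k) := by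
      rw [← hf0, PowerSeries.sub_const_eq_X_mul_shift]
    have hXA' : PowerSeries.X * A' = A - PowerSeries.C (a k) * B := by
      ext j
      rcases j with _ | j
      · simp only [PowerSeries.coeff_zero_X_mul, map_sub, PowerSeries.coeff_C_mul, hA0, hB0,
          sub_self]
      · simp only [PowerSeries.coeff_succ_X_mul, map_sub, PowerSeries.coeff_C_mul, hA',
          PowerSeries.coeff_mk]
    have hSB : S * B = A' := by
      refine mul_left_cancel₀ PowerSeries.X_ne_zero ?_
      rw [hXA', ← mul_assoc, hXS, sub_mul, hAB]
    refine ⟨A', (1 - PowerSeries.C (conj (a k)) * f) * B, ?_, fun j hj => ?_, fun j hj => ?_⟩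
    · have h0 : PowerSeries.constantCoeff (1 - PowerSeries.C (conj (a k)) * f) ≠ 0 := by
        have h1 := h.nodeForm_self_succ hζ hk
        have h2 := IsSzegoSeq.nodeForm_self_ne_zero hω hinj a hk
        intro h3
        rw [map_sub, map_one, map_mul, PowerSeries.constantCoeff_C, hf0] at h3
        exact h2 (by rw [h1, mul_comm (a k), h3, zero_mul])
      rw [schurIterate, ← hf, hf0, ← hS, ← hSB]
      calc _ = S * ((1 - PowerSeries.C (conj (a k)) * f)⁻¹ *
            (1 - PowerSeries.C (conj (a k)) * f)) * B := by ring
        _ = S * B := by rw [PowerSeries.inv_mul_cancel _ h0, mul_one]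
    · rw [sub_mul, one_mul, mul_assoc, hAB, map_sub, PowerSeries.coeff_C_mul, hB j (by omega),
        hA j (by omega), szego_succ, nodeForm_sub_left, nodeForm_C_mul_left, ← add_assoc,
        pow_succ' _ (j + k), nodeForm_X_mul_X_mul hζ]
    · rw [hA', PowerSeries.coeff_mk, hB (j + 1) (by omega), hA (j + 1) (by omega), szegoStar_succ,
        nodeForm_sub_left, nodeForm_C_mul_left, show j + 1 + k + 1 = j + (k + 1) + 1 by ring,
        show j + 1 + k = j + (k + 1) by ring, pow_succ' _ (j + (k + 1)),
        nodeForm_X_mul_X_mul hζ]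

/-- Geronimus' theorem for truncated moments: the parameters of the Schur algorithm are the
Verblunsky coefficients. -/
lemma IsSzegoSeq.schurParams_eq (h : IsSzegoSeq ω ζ a) (hω : ∀ j, 0 < ω j)
    (hζ : ∀ j, ‖ζ j‖ = 1) (hinj : Function.Injective ζ) (k : Fin (n - 1)) :
    schurParams n (trigMoment (nodeMeasure ω ζ)) k = a k := by
  have hk : (k : ℕ) + 1 < n := by have := k.2; omega
  obtain ⟨A, B, hAB, hB, hA⟩ := h.schurIterate_mul_eq hω hζ hinj
    (c := fun j => if j < n then trigMoment (nodeMeasure ω ζ) (-(j : ℤ)) else 0)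
    (fun j hj => by rw [if_pos hj, trigMoment_nodeMeasure (fun j => (hω j).le) hζ]) k (by omega)
  have hB0 := hB 0 (by omega)
  have hA0 := hA 0 (by omega)
  rw [zero_add, h.nodeForm_X_pow_self (by omega)] at hB0
  rw [zero_add, h.nodeForm_star_X_pow_succ hζ hk] at hA0
  have := congrArg PowerSeries.constantCoeff hAB
  rw [map_mul, ← PowerSeries.coeff_zero_eq_constantCoeff_apply,
    ← PowerSeries.coeff_zero_eq_constantCoeff_apply,
    ← PowerSeries.coeff_zero_eq_constantCoeff_apply, hA0, hB0] at this
  rw [schurParams, ← PowerSeries.coeff_zero_eq_constantCoeff_apply]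
  exact mul_right_cancel₀ (IsSzegoSeq.nodeForm_self_ne_zero hω hinj a (show (k : ℕ) < n by omega))
    this

end

/-! ### Angles on the unit circle -/

lemma exists_angle {p z : ℂ} (hp : ‖p‖ = 1) (hz : ‖z‖ = 1) :
    ∃ θ : ℝ, 0 < θ ∧ θ ≤ 2 * Real.pi ∧ z = p * Complex.exp (θ * Complex.I) := by
  have hp0 : p ≠ 0 := norm_ne_zero_iff.mp (by rw [hp]; exact one_ne_zero)
  have h1 : z = p * Complex.exp ((z / p).arg * Complex.I) := by
    have := Complex.norm_mul_exp_arg_mul_I (z / p)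
    rw [norm_div, hz, hp, div_one, Complex.ofReal_one, one_mul] at this
    rw [this, mul_div_cancel₀ _ hp0]
  have h2 := Complex.arg_le_pi (z / p)
  have h3 := Complex.neg_pi_lt_arg (z / p)
  have hpi := Real.pi_pos
  rcases lt_or_ge 0 (z / p).arg with h | h
  · exact ⟨_, h, by linarith, h1⟩
  · refine ⟨(z / p).arg + 2 * Real.pi, by linarith, by linarith, ?_⟩
    push_cast
    rw [add_mul, Complex.exp_add, Complex.exp_two_pi_mul_I, mul_one]
    exact h1

lemma angle_unique {p : ℂ} (hp : p ≠ 0) {s t : ℝ}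
    (h : p * Complex.exp (s * Complex.I) = p * Complex.exp (t * Complex.I))
    (h1 : s - t < 2 * Real.pi) (h2 : t - s < 2 * Real.pi) : s = t := by
  obtain ⟨k, hk⟩ := Complex.exp_eq_exp_iff_exists_int.mp (mul_left_cancel₀ hp h)
  have hk' : (s : ℂ) = t + k * (2 * Real.pi) :=
    mul_right_cancel₀ Complex.I_ne_zero (by rw [hk]; ring)
  have hk'' : s = t + k * (2 * Real.pi) := by exact_mod_cast hk'
  have hpi := Real.pi_pos
  have h3 : (k : ℝ) < 1 := by nlinarith
  have h4 : (-1 : ℝ) < k := by nlinarith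
  have h5 : k < 1 := by exact_mod_cast h3
  have h6 : -1 < k := by exact_mod_cast h4
  have : k = 0 := by omega
  rw [hk'', this]; simp

lemma exp_sub_two_pi (s : ℝ) :
    Complex.exp (((s - 2 * Real.pi : ℝ) : ℂ) * Complex.I) = Complex.exp (s * Complex.I) := by
  push_cast
  rw [sub_mul, Complex.exp_sub, Complex.exp_two_pi_mul_I, div_one]

lemma exp_add_angle (p : ℂ) (s t : ℝ) :
    p * Complex.exp ((s + t : ℝ) * Complex.I) =
      p * Complex.exp (s * Complex.I) * Complex.exp (t * Complex.I) := by
  push_cast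
  rw [add_mul, Complex.exp_add, mul_assoc]

/-- The chord between two points of the circle in terms of the half angle. -/
lemma chord_eq (p : ℂ) (s t : ℝ) :
    p * Complex.exp (s * Complex.I) - p * Complex.exp (t * Complex.I) =
      2 * Complex.I * p * Complex.exp ((s / 2 : ℝ) * Complex.I) *
        Complex.exp ((t / 2 : ℝ) * Complex.I) * (Real.sin ((s - t) / 2) : ℂ) := by
  set E := Complex.exp ((s / 2 : ℝ) * Complex.I) with hE
  set F := Complex.exp ((t / 2 : ℝ) * Complex.I) with hF
  have hE0 : E ≠ 0 := Complex.exp_ne_zero _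
  have hF0 : F ≠ 0 := Complex.exp_ne_zero _
  have h1 : Complex.exp (s * Complex.I) = E * E := by
    rw [hE, ← Complex.exp_add]; congr 1; push_cast; ring
  have h2 : Complex.exp (t * Complex.I) = F * F := by
    rw [hF, ← Complex.exp_add]; congr 1; push_cast; ring
  have h3 : Complex.exp (((s - t) / 2 : ℝ) * Complex.I) = E / F := by
    rw [hE, hF, ← Complex.exp_sub]; congr 1; push_cast; ring
  have h4 : Complex.exp (-((s - t) / 2 : ℝ) * Complex.I) = F / E := by
    rw [hE, hF, ← Complex.exp_sub]; congr 1; push_cast; ring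
  rw [Complex.ofReal_sin, Complex.sin, h3, h4, h1, h2]
  field_simp
  linear_combination (p * (E ^ 2 - F ^ 2)) * Complex.I_sq

lemma sin_half_pos {x : ℝ} (h0 : 0 < x) (h1 : x < 2 * Real.pi) : 0 < Real.sin (x / 2) :=
  Real.sin_pos_of_pos_of_lt_pi (by linarith) (by linarith)

lemma sin_half_neg {x : ℝ} (h0 : x < 0) (h1 : -(2 * Real.pi) < x) : Real.sin (x / 2) < 0 :=
  Real.sin_neg_of_neg_of_neg_pi_lt (by linarith) (by linarith)

/-! ### Positive weights force strict interlacing -/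

/-- If two points `ξ_a`, `ξ_b` lay on a common arc of `Z_n`, pair the orthogonality relations with
`z G`, where `G = Ψ_m / ((z - ξ_a) (z - ξ_b))`. This gives `∑_j ω_j |G (ζ_j)|² (ζ_j - ξ_a) (ζ_j -
ξ_b) conj ζ_j = 0`, but all the terms are nonzero and have the same argument, since all the `ζ_j`
lie on the same side of the chord from `ξ_a` to `ξ_b`. -/
theorem strictlyInterlaces_of_mem_positiveWeights {n m : ℕ} {ω : Fin n → ℝ} {ζ : Fin n → ℂ}
    {ξ : Fin m → ℂ} (hζ : ∀ j, ‖ζ j‖ = 1)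
    (hdisj : Disjoint (Set.range ζ) (Set.range ξ)) (hω : ω ∈ positiveWeights ζ ξ) :
    StrictlyInterlaces (Set.range ξ) (Set.range ζ) := by
  obtain ⟨hpos, horth⟩ := (mem_positiveWeights_iff hζ ξ).mp hω
  rintro p ⟨j₀, rfl⟩ q ⟨j₁, rfl⟩ hempty x ⟨⟨s, t, hs, hst, ht, hq, hx⟩, ⟨a, rfl⟩⟩ y
    ⟨⟨s', t', hs', hst', ht', hq', hy⟩, ⟨b, rfl⟩⟩
  by_contra hne
  have hab : a ≠ b := fun h => hne (by rw [h])
  set p := ζ j₀ with hp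
  have hp1 : ‖p‖ = 1 := hζ j₀
  have hp0 : p ≠ 0 := norm_ne_zero_iff.mp (by rw [hp1]; exact one_ne_zero)
  set G : ℂ[X] := ∏ k ∈ (Finset.univ.erase a).erase b, (X - C (ξ k)) with hG
  have hΨ : nodePoly ξ = (X - C (ξ a)) * ((X - C (ξ b)) * G) := by
    rw [hG, Finset.mul_prod_erase _ (fun k => X - C (ξ k)) (by simpa using hab.symm),
      Finset.mul_prod_erase _ (fun k => X - C (ξ k)) (Finset.mem_univ a), nodePoly]
  have hGm : G.Monic := monic_prod_of_monic _ _ fun k _ => monic_X_sub_C _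
  have hGd : G.natDegree + 2 = m := by
    have := nodePoly_natDegree ξ
    rw [hΨ, (monic_X_sub_C _).natDegree_mul ((monic_X_sub_C _).mul hGm),
      (monic_X_sub_C _).natDegree_mul hGm, natDegree_X_sub_C, natDegree_X_sub_C] at this
    omega
  have hzero : nodeForm ω ζ (nodePoly ξ) (X * G) = 0 := by
    refine nodeForm_eq_zero_of_support ω ζ fun i hi => ?_
    rcases i with _ | i
    · simp at hi
    · rw [coeff_X_mul] at hi
      exact horth _ (by omega) (by have := le_natDegree_of_ne_zero hi; omega)
  have hGζ : ∀ j, G.eval (ζ j) ≠ 0 := by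
    intro j h
    have : (nodePoly ξ).eval (ζ j) = 0 := by rw [hΨ]; simp [h]
    exact Set.disjoint_left.mp hdisj ⟨j, rfl⟩ ((nodePoly_eval_eq_zero_iff ξ _).mp this)
  have hangle : ∀ j, ∃ r : ℝ, 0 < r ∧ (ζ j - ξ a) * (ζ j - ξ b) * conj (ζ j) =
      (-4 * p * Complex.exp ((s / 2 : ℝ) * Complex.I) *
        Complex.exp ((s' / 2 : ℝ) * Complex.I)) * r := by
    intro j
    obtain ⟨θ, hθ0, hθ1, hθ⟩ := exists_angle hp1 (hζ j)
    have hsθ : s < θ := by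
      by_contra! h
      exact Set.eq_empty_iff_forall_notMem.mp hempty (ζ j)
        ⟨⟨θ, t, hθ0, h.trans_lt hst, ht, hq, hθ⟩, ⟨j, rfl⟩⟩
    have hsθ' : s' < θ := by
      by_contra! h
      exact Set.eq_empty_iff_forall_notMem.mp hempty (ζ j)
        ⟨⟨θ, t', hθ0, h.trans_lt hst', ht', hq', hθ⟩, ⟨j, rfl⟩⟩
    refine ⟨Real.sin ((θ - s) / 2) * Real.sin ((θ - s') / 2),
      mul_pos (sin_half_pos (by linarith) (by linarith)) (sin_half_pos (by linarith) (by linarith)),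
      ?_⟩
    have h1 := mul_conj_of_norm_one (hζ j)
    have h2 : ζ j = p * (Complex.exp ((θ / 2 : ℝ) * Complex.I) *
        Complex.exp ((θ / 2 : ℝ) * Complex.I)) := by
      rw [hθ, ← Complex.exp_add]; congr 2; push_cast; ring
    have h3 := chord_eq p θ s
    have h4 := chord_eq p θ s'
    rw [← hθ, ← hx] at h3
    rw [← hθ, ← hy] at h4
    rw [h3, h4, Complex.ofReal_mul]
    set E := Complex.exp ((θ / 2 : ℝ) * Complex.I)
    set F := Complex.exp ((s / 2 : ℝ) * Complex.I)
    set F' := Complex.exp ((s' / 2 : ℝ) * Complex.I)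
    set u := (Real.sin ((θ - s) / 2) : ℂ)
    set v := (Real.sin ((θ - s') / 2) : ℂ)
    have h5 : p * (E * E) * conj (ζ j) = 1 := by rw [← h2, h1]
    linear_combination (4 * p ^ 2 * E ^ 2 * F * F' * u * v * conj (ζ j)) * Complex.I_sq -
      4 * p * F * F' * u * v * h5
  choose r hr hreq using hangle
  set κ := -4 * p * Complex.exp ((s / 2 : ℝ) * Complex.I) *
        Complex.exp ((s' / 2 : ℝ) * Complex.I) with hκ
  have hκ0 : κ ≠ 0 := by
    simp [hκ, hp0, Complex.exp_ne_zero]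
  have hsum : nodeForm ω ζ (nodePoly ξ) (X * G) =
      κ * ((∑ j, ω j * (‖G.eval (ζ j)‖ ^ 2 * r j) : ℝ) : ℂ) := by
    rw [nodeForm]
    push_cast
    rw [Finset.mul_sum]
    refine Finset.sum_congr rfl fun j _ => ?_
    have h1 : G.eval (ζ j) * conj (G.eval (ζ j)) = ((‖G.eval (ζ j)‖ : ℝ) : ℂ) ^ 2 := by
      rw [Complex.mul_conj, Complex.normSq_eq_norm_sq]; push_cast; rfl
    rw [hΨ, ← h1]
    simp only [eval_mul, eval_sub, eval_X, eval_C, map_mul]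
    linear_combination (ω j * (G.eval (ζ j) * conj (G.eval (ζ j)))) * hreq j
  have hsp : 0 < ∑ j, ω j * (‖G.eval (ζ j)‖ ^ 2 * r j) :=
    Finset.sum_pos (fun j _ => mul_pos (hpos j)
      (mul_pos (pow_pos (norm_pos_iff.mpr (hGζ j)) 2) (hr j))) ⟨j₀, Finset.mem_univ _⟩
  rw [hsum] at hzero
  rcases mul_eq_zero.mp hzero with h | h
  · exact hκ0 h
  · exact hsp.ne' (by exact_mod_cast h)

/-! ### Strict interlacing provides positive weights -/

/-- If `η_k` is the only point of `{η_i}` on the arc that starts at `ξ_k` and ends at the next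
point of `{ξ_i}`, then suitable positive weights at the nodes `η_k` solve the linear system. They
are found from the identities `∑_k η_k^r / ∏_{i ≠ k} (η_k - η_i) = 0` for `r ≤ m - 2`: the
quotient of `η_k^{m-1}` by `Ψ_m (η_k) ∏_{i ≠ k} (η_k - η_i)` is a constant times an inverse
product of sines of half angles, which is positive because for `i ≠ k` the angle of `η_k` exceeds
either both or none of the angles of `η_i` and `ξ_i`. -/
lemma exists_weights_of_interlaced {m : ℕ} {p : ℂ} (hp : ‖p‖ = 1) {θ φ : Fin m → ℝ}
    {η ξ : Fin m → ℂ} (hη : ∀ k, η k = p * Complex.exp (θ k * Complex.I))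
    (hξ : ∀ k, ξ k = p * Complex.exp (φ k * Complex.I)) (hφ0 : ∀ k, 0 ≤ φ k)
    (hφ : Function.Injective φ) (hθ : ∀ k, θ k < 2 * Real.pi) (hlt : ∀ k, φ k < θ k)
    (hgt : ∀ k i, φ k < φ i → θ k < φ i) :
    ∃ w : Fin m → ℝ, (∀ k, 0 < w k) ∧ ∀ l : ℕ, 1 ≤ l → l + 1 ≤ m →
      ∑ k, (w k : ℂ) * (nodePoly ξ).eval (η k) * conj (η k ^ l) = 0 := by
  have hp0 : p ≠ 0 := norm_ne_zero_iff.mp (by rw [hp]; exact one_ne_zero)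
  have hη1 : ∀ k, ‖η k‖ = 1 := fun k => by
    rw [hη, norm_mul, hp, Complex.norm_exp_ofReal_mul_I, one_mul]
  have hcmp : ∀ k i, i ≠ k → (θ i < θ k ∧ φ i < θ k) ∨ (θ k < θ i ∧ θ k < φ i) := by
    intro k i hik
    rcases lt_or_gt_of_ne (hφ.ne hik) with h | h
    · exact Or.inl ⟨(hgt i k h).trans (hlt k), h.trans (hlt k)⟩
    · exact Or.inr ⟨(hgt k i h).trans (hlt i), hgt k i h⟩
  have hθ0 : ∀ k, 0 < θ k := fun k => (hφ0 k).trans_lt (hlt k)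
  have hinj : Function.Injective η := by
    intro i k hik
    by_contra hne
    rw [hη, hη] at hik
    have := angle_unique hp0 hik (by linarith [hθ0 k, hθ i]) (by linarith [hθ0 i, hθ k])
    rcases hcmp k i hne with h | h <;> linarith
  set u : Fin m → Fin m → ℝ := fun k i =>
    Real.sin ((θ k - θ i) / 2) * Real.sin ((θ k - φ i) / 2) with hu
  have hu0 : ∀ k i, i ≠ k → 0 < u k i := by
    intro k i hik
    have h1 := hθ k
    have h2 := hθ i
    have h3 := hθ0 k
    have h4 := hθ0 i
    have h5 := hφ0 i
    have h6 := hlt i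
    rcases hcmp k i hik with h | h
    · exact mul_pos (sin_half_pos (by linarith) (by linarith))
        (sin_half_pos (by linarith) (by linarith))
    · exact mul_pos_of_neg_of_neg (sin_half_neg (by linarith) (by linarith))
        (sin_half_neg (by linarith) (by linarith))
  set S : Fin m → ℝ := fun k =>
    Real.sin ((θ k - φ k) / 2) * ∏ i ∈ Finset.univ.erase k, u k i with hS
  have hS0 : ∀ k, 0 < S k := fun k => mul_pos
    (sin_half_pos (by linarith [hlt k]) (by linarith [hφ0 k, hθ k]))
    (Finset.prod_pos fun i hi => hu0 k i (Finset.ne_of_mem_erase hi))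
  set E : Fin m → ℂ := fun k => Complex.exp ((θ k / 2 : ℝ) * Complex.I) with hE
  set F : Fin m → ℂ := fun k => Complex.exp ((φ k / 2 : ℝ) * Complex.I) with hF
  have hηE : ∀ k, η k = p * E k ^ 2 := by
    intro k
    rw [hη, hE, ← Complex.exp_nat_mul]; congr 2; push_cast; ring
  set d := 2 * Complex.I * p with hd
  have hηη : ∀ k i, η k - η i = d * E k * E i * (Real.sin ((θ k - θ i) / 2) : ℂ) := fun k i => by
    rw [hη, hη]; exact chord_eq p _ _
  have hηξ : ∀ k i, η k - ξ i = d * E k * F i * (Real.sin ((θ k - φ i) / 2) : ℂ) := fun k i => by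
    rw [hη, hξ]; exact chord_eq p _ _
  set H : Fin m → ℂ := fun k => ∏ i ∈ Finset.univ.erase k, (η k - η i) with hH
  have hH0 : ∀ k, H k ≠ 0 := fun k => Finset.prod_ne_zero_iff.mpr fun i hi =>
    sub_ne_zero.mpr (hinj.ne (Finset.ne_of_mem_erase hi).symm)
  set c : ℂ := d * (d ^ 2) ^ (m - 1) * (∏ i, E i * F i) / p ^ (m - 1) with hc
  have hprod : ∀ k, (nodePoly ξ).eval (η k) * H k = c * η k ^ (m - 1) * S k := by
    intro k
    have h1 : (nodePoly ξ).eval (η k) = (η k - ξ k) *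
        ∏ i ∈ Finset.univ.erase k, (η k - ξ i) := by
      rw [Finset.mul_prod_erase _ (fun i => η k - ξ i) (Finset.mem_univ k), nodePoly, eval_prod]
      simp
    have h2 : ∏ i ∈ Finset.univ.erase k, ((η k - ξ i) * (η k - η i)) =
        (d ^ 2) ^ (m - 1) * (E k ^ 2) ^ (m - 1) *
          (∏ i ∈ Finset.univ.erase k, E i * F i) *
          ((∏ i ∈ Finset.univ.erase k, u k i : ℝ) : ℂ) := by
      have hcard : (Finset.univ.erase k).card = m - 1 := by
        rw [Finset.card_erase_of_mem (Finset.mem_univ k), Finset.card_univ, Fintype.card_fin]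
      rw [← hcard, ← Finset.prod_const, ← Finset.prod_const, Complex.ofReal_prod,
        ← Finset.prod_mul_distrib, ← Finset.prod_mul_distrib, ← Finset.prod_mul_distrib]
      refine Finset.prod_congr rfl fun i _ => ?_
      rw [hηη, hηξ, hu, Complex.ofReal_mul]; ring
    have h3 : (∏ i, E i * F i) = E k * F k * ∏ i ∈ Finset.univ.erase k, E i * F i :=
      (Finset.mul_prod_erase _ (fun i => E i * F i) (Finset.mem_univ k)).symm
    rw [h1, hH, mul_assoc, ← Finset.prod_mul_distrib, h2, hηξ, hc, h3, hηE, hS, mul_pow,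
      Complex.ofReal_mul]
    field_simp
    ring
  refine ⟨fun k => (S k)⁻¹, fun k => inv_pos.mpr (hS0 k), fun l hl hlm => ?_⟩
  have hterm : ∀ k, (((S k)⁻¹ : ℝ) : ℂ) * (nodePoly ξ).eval (η k) * conj (η k ^ l) =
      c * ((X ^ (m - 1 - l) : ℂ[X]).eval (η k) / H k) := by
    intro k
    have h1 : η k ^ l * conj (η k ^ l) = 1 :=
      mul_conj_of_norm_one (by rw [norm_pow, hη1, one_pow])
    have h2 : η k ^ (m - 1) = η k ^ (m - 1 - l) * η k ^ l := by
      rw [← pow_add]; congr 1; omega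
    have h3 : (S k : ℂ) ≠ 0 := by exact_mod_cast (hS0 k).ne'
    have h4 := hH0 k
    have h5 := hprod k
    rw [eval_pow, eval_X, Complex.ofReal_inv]
    field_simp
    rw [h2] at h5
    linear_combination conj (η k ^ l) * h5 + (c * η k ^ (m - 1 - l) * S k) * h1
  rw [Finset.sum_congr rfl fun k _ => hterm k, ← Finset.mul_sum]
  have hcoeff := Lagrange.coeff_eq_sum (s := Finset.univ) (v := η) hinj.injOn
    (P := X ^ (m - 1 - l)) (by
      rw [degree_X_pow, Finset.card_univ, Fintype.card_fin]
      exact_mod_cast (by omega))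
  rw [Finset.card_univ, Fintype.card_fin, coeff_X_pow, if_neg (by omega)] at hcoeff
  rw [← hcoeff, mul_zero]

/-- Strict interlacing: between two points of `Z_m` there is a point of `Z_n`. Otherwise the nearest
nodes outside would bound an arc of `Z_n` that contains both points. For `δ = 2π` the two points
coincide. -/
lemma StrictlyInterlaces.exists_between {n m : ℕ} {ζ : Fin n → ℂ} {ξ : Fin m → ℂ}
    (h : StrictlyInterlaces (Set.range ξ) (Set.range ζ)) (hn : 0 < n)
    (hζ : ∀ j, ‖ζ j‖ = 1) (hξ : ∀ k, ‖ξ k‖ = 1)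
    (hdisj : Disjoint (Set.range ζ) (Set.range ξ)) {a b : Fin m} {δ : ℝ} (hδ0 : 0 < δ)
    (hab : ξ b = ξ a * Complex.exp (δ * Complex.I)) :
    ∃ (j : Fin n) (u : ℝ), 0 < u ∧ u < δ ∧ ζ j = ξ a * Complex.exp (u * Complex.I) := by
  have hx0 : ξ a ≠ 0 := norm_ne_zero_iff.mp (by rw [hξ]; exact one_ne_zero)
  have hne : ∀ j k, ζ j ≠ ξ k := fun j k hjk =>
    Set.disjoint_left.mp hdisj ⟨j, rfl⟩ ⟨k, hjk.symm⟩
  choose τ hτ0 hτ1 hτ using fun j => exists_angle (hξ a) (hζ j)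
  have hτ2 : ∀ j, τ j < 2 * Real.pi := by
    intro j
    refine lt_of_le_of_ne (hτ1 j) fun h => hne j a ?_
    rw [hτ, h]; push_cast; rw [Complex.exp_two_pi_mul_I, mul_one]
  by_contra! hcon
  have hτδ : ∀ j, δ < τ j := by
    intro j
    by_contra! hj
    rcases hj.lt_or_eq with hj | hj
    · exact hcon j (τ j) (hτ0 j) hj (hτ j)
    · exact hne j b (by rw [hab, hτ, hj])
  have hδ2 : δ < 2 * Real.pi := (hτδ ⟨0, hn⟩).trans (hτ2 _)
  -- the nodes next to the arc from `ξ a` to `ξ b`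
  obtain ⟨i, -, hi⟩ := Finset.exists_min_image Finset.univ τ ⟨⟨0, hn⟩, Finset.mem_univ _⟩
  obtain ⟨j, -, hj⟩ := Finset.exists_max_image Finset.univ τ ⟨⟨0, hn⟩, Finset.mem_univ _⟩
  have hij := hi j (Finset.mem_univ j)
  have hj0 : ζ j ≠ 0 := norm_ne_zero_iff.mp (by rw [hζ]; exact one_ne_zero)
  have hmove : ∀ s : ℝ, ζ j * Complex.exp (s * Complex.I) =
      ξ a * Complex.exp ((τ j - 2 * Real.pi + s : ℝ) * Complex.I) := by
    intro s
    rw [exp_add_angle, exp_sub_two_pi, ← hτ]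
  have hq : ζ i = ζ j * Complex.exp ((τ i - τ j + 2 * Real.pi : ℝ) * Complex.I) := by
    rw [hmove, hτ i]; congr 3; push_cast; ring
  have hempty : openArc (ζ j) (ζ i) ∩ Set.range ζ = ∅ := by
    rw [Set.eq_empty_iff_forall_notMem]
    rintro z ⟨⟨s, t, hs, hst, ht, hqt, hz⟩, ⟨k, rfl⟩⟩
    have htt : t = τ i - τ j + 2 * Real.pi :=
      angle_unique hj0 (hqt.symm.trans hq) (by linarith [hτ0 i, hτ2 j]) (by linarith)
    rw [hmove] at hz
    have hik := hi k (Finset.mem_univ k)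
    have hkj := hj k (Finset.mem_univ k)
    rcases lt_trichotomy (τ j - 2 * Real.pi + s) 0 with h0 | h0 | h0
    · have h1 : ζ k = ξ a * Complex.exp ((τ j + s : ℝ) * Complex.I) := by
        rw [hz, ← exp_sub_two_pi (τ j + s)]; congr 3; push_cast; ring
      have := angle_unique hx0 ((hτ k).symm.trans h1) (by linarith [hτ2 k, hτ0 j])
        (by linarith [hτ0 k])
      linarith
    · rw [h0] at hz
      exact hne k a (by rw [hz]; simp)
    · have := angle_unique hx0 ((hτ k).symm.trans hz) (by linarith [hτ2 k])
        (by linarith [hτ0 k, hτ2 i])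
      linarith
  have hxa : ξ a = ζ j * Complex.exp ((2 * Real.pi - τ j : ℝ) * Complex.I) := by
    rw [hmove]; ring_nf; simp
  have hxb : ξ b = ζ j * Complex.exp ((2 * Real.pi - τ j + δ : ℝ) * Complex.I) := by
    rw [hmove, hab]; ring_nf
  have := h (ζ j) ⟨j, rfl⟩ (ζ i) ⟨i, rfl⟩ hempty
    ⟨⟨_, _, by linarith [hτ2 j], by linarith [hτ0 i], by linarith, hq, hxa⟩, ⟨a, rfl⟩⟩
    ⟨⟨_, _, by linarith [hτ2 j], by linarith [hτδ i], by linarith, hq, hxb⟩, ⟨b, rfl⟩⟩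
  rw [hab] at this
  have h1 : ξ a * Complex.exp ((0 : ℝ) * Complex.I) = ξ a * Complex.exp (δ * Complex.I) := by
    rw [← this]; simp
  have := angle_unique hx0 h1 (by linarith) (by linarith)
  linarith

/-- For every node `ζ_{j₀}` there is a nonnegative solution of the linear system that is positive at
`ζ_{j₀}`, and zero at the other nodes on the arc between points of `Z_m` that contains `ζ_{j₀}`; the
map `κ` assigns to each node its arc. -/
lemma exists_nonneg_weights {n m : ℕ} (hm : 0 < m) (hn : 0 < n) {ζ : Fin n → ℂ} {ξ : Fin m → ℂ}
    (h : StrictlyInterlaces (Set.range ξ) (Set.range ζ))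
    (hζ : ∀ j, ‖ζ j‖ = 1) (hξ : ∀ k, ‖ξ k‖ = 1) (hξinj : Function.Injective ξ)
    (hdisj : Disjoint (Set.range ζ) (Set.range ξ)) :
    ∃ κ : Fin n → Fin m, ∀ j₀, ∃ w : Fin n → ℝ, (∀ j, 0 ≤ w j) ∧ 0 < w j₀ ∧
      (∀ j, j ≠ j₀ → κ j = κ j₀ → w j = 0) ∧
      ∀ l, 1 ≤ l → l + 1 ≤ m → nodeForm w ζ (nodePoly ξ) (X ^ l) = 0 := by
  classical
  have hpi := Real.pi_pos
  set k₀ : Fin m := ⟨0, hm⟩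
  set p := ξ k₀ with hp
  have hp1 : ‖p‖ = 1 := hξ k₀
  have hp0 : p ≠ 0 := norm_ne_zero_iff.mp (by rw [hp1]; exact one_ne_zero)
  have hne : ∀ j k, ζ j ≠ ξ k := fun j k hjk =>
    Set.disjoint_left.mp hdisj ⟨j, rfl⟩ ⟨k, hjk.symm⟩
  -- angles relative to the base point `p`, in `[0, 2π)`
  have hangle : ∀ z : ℂ, ‖z‖ = 1 → ∃ θ : ℝ, 0 ≤ θ ∧ θ < 2 * Real.pi ∧
      z = p * Complex.exp (θ * Complex.I) := by
    intro z hz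
    obtain ⟨θ, h0, h1, h2⟩ := exists_angle hp1 hz
    rcases h1.lt_or_eq with h1 | h1
    · exact ⟨θ, h0.le, h1, h2⟩
    · refine ⟨0, le_rfl, by linarith, ?_⟩
      rw [h2, h1, ← exp_sub_two_pi]; simp
  choose φ hφ0 hφ1 hφ using fun k => hangle (ξ k) (hξ k)
  choose θ hθ0 hθ1 hθ using fun j => hangle (ζ j) (hζ j)
  have hφinj : Function.Injective φ := fun i k hik => hξinj (by rw [hφ, hφ, hik])
  have hφk₀ : φ k₀ = 0 := by
    have h1 : p * Complex.exp (φ k₀ * Complex.I) = p * Complex.exp ((0 : ℝ) * Complex.I) := by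
      rw [← hφ]; simp [hp]
    exact angle_unique hp0 h1 (by linarith [hφ1 k₀]) (by linarith [hφ0 k₀])
  have hθφ : ∀ j k, θ j ≠ φ k := fun j k hjk => hne j k (by rw [hθ, hφ, hjk])
  let Arc : Fin n → Fin m → Prop := fun j k => φ k < θ j ∧ ∀ i, φ k < φ i → θ j < φ i
  have hArc_unique : ∀ j k k', Arc j k → Arc j k' → k = k' := by
    rintro j k k' ⟨h1, h2⟩ ⟨h3, h4⟩
    by_contra hkk
    rcases lt_or_gt_of_ne (hφinj.ne hkk) with h | h
    · linarith [h2 _ h]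
    · linarith [h4 _ h]
  have hArc_exists : ∀ j, ∃ k, Arc j k := by
    intro j
    obtain ⟨k, hk, hmax⟩ := Finset.exists_max_image (Finset.univ.filter fun k => φ k < θ j) φ
      ⟨k₀, by
        rw [Finset.mem_filter, hφk₀]
        exact ⟨Finset.mem_univ _, lt_of_le_of_ne (hθ0 j) (by
          have := hθφ j k₀; rw [hφk₀] at this; exact this.symm)⟩⟩
    refine ⟨k, (Finset.mem_filter.mp hk).2, fun i hi => ?_⟩
    by_contra! hcon
    have := hmax i (Finset.mem_filter.mpr ⟨Finset.mem_univ i, lt_of_le_of_ne hcon (hθφ j i).symm⟩)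
    linarith
  have hArc_surj : ∀ k, ∃ j, Arc j k := by
    intro k
    -- the angle `c` of the next point of `Z_m`, or `2π` if there is none before the base point
    obtain ⟨b, c, hc0, hc1, hb, hnext⟩ : ∃ (b : Fin m) (c : ℝ), φ k < c ∧ c ≤ 2 * Real.pi ∧
        ξ b = p * Complex.exp (c * Complex.I) ∧ ∀ i, φ k < φ i → c ≤ φ i := by
      by_cases hlast : ∃ i, φ k < φ i
      · obtain ⟨b, hb, hmin⟩ := Finset.exists_min_image
          (Finset.univ.filter fun i => φ k < φ i) φ (by
            obtain ⟨i, hi⟩ := hlast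
            exact ⟨i, Finset.mem_filter.mpr ⟨Finset.mem_univ _, hi⟩⟩)
        exact ⟨b, φ b, (Finset.mem_filter.mp hb).2, (hφ1 b).le, hφ b, fun i hi =>
          hmin i (Finset.mem_filter.mpr ⟨Finset.mem_univ _, hi⟩)⟩
      · refine ⟨k₀, 2 * Real.pi, hφ1 k, le_rfl, ?_, fun i hi => absurd ⟨i, hi⟩ hlast⟩
        rw [← exp_sub_two_pi]; simp [hp]
    obtain ⟨j, u, hu0, hu1, hj⟩ := h.exists_between hn hζ hξ hdisj (a := k) (b := b) (δ := c - φ k)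
      (by linarith) (by
        rw [hφ k, ← exp_add_angle, hb]; congr 3; push_cast; ring)
    have hθj : θ j = φ k + u := by
      refine angle_unique hp0 (?_ : _ = p * Complex.exp ((φ k + u : ℝ) * Complex.I))
        (by linarith [hθ1 j, hφ0 k]) (by linarith [hθ0 j])
      rw [← hθ, exp_add_angle, ← hφ, hj]
    refine ⟨j, by linarith, fun i hi => by linarith [hnext i hi]⟩
  choose κ hκ using hArc_exists
  choose σ₀ hσ₀ using hArc_surj
  refine ⟨κ, fun j₀ => ?_⟩
  -- one node on each arc of `Z_m`, with `ζ_{j₀}` on its own arc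
  set σ : Fin m → Fin n := Function.update σ₀ (κ j₀) j₀ with hσdef
  have hσ : ∀ k, Arc (σ k) k := by
    intro k
    by_cases hk : k = κ j₀
    · subst hk; simpa [σ] using hκ j₀
    · simpa [σ, hk] using hσ₀ k
  obtain ⟨w, hw0, hw⟩ := exists_weights_of_interlaced hp1 (η := fun k => ζ (σ k)) (ξ := ξ)
    (fun k => hθ (σ k)) hφ hφ0 hφinj (fun k => hθ1 (σ k)) (fun k => (hσ k).1)
    (fun k i hi => (hσ k).2 i hi)
  refine ⟨fun j => ∑ k, if σ k = j then w k else 0, fun j => Finset.sum_nonneg fun k _ => ?_,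
    ?_, fun j hj hjκ => ?_, fun l hl hlm => ?_⟩
  · split_ifs
    · exact (hw0 k).le
    · exact le_rfl
  · refine Finset.sum_pos' (fun k _ => ?_) ⟨κ j₀, Finset.mem_univ _, ?_⟩
    · split_ifs
      · exact (hw0 k).le
      · exact le_rfl
    · simp [σ, hw0]
  · refine Finset.sum_eq_zero fun k _ => if_neg fun hk => hj ?_
    have h1 : k = κ j := hArc_unique j k (κ j) (hk ▸ hσ k) (hκ j)
    rw [← hk, h1, hjκ]
    simp [σ]
  · rw [← hw l hl hlm, nodeForm]
    simp only [Complex.ofReal_sum, Finset.sum_mul]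
    rw [Finset.sum_comm]
    refine Finset.sum_congr rfl fun k _ => ?_
    rw [Finset.sum_eq_single (σ k)]
    · simp
    · intro j _ hj; simp [hj.symm]
    · simp

/-- Superposing the solutions of `exists_nonneg_weights` gives positive weights, and, as there are
more nodes than arcs, two choices that are not proportional. -/
theorem exists_positiveWeights_not_proportional {n m : ℕ} (hm : 0 < m) (hmn : m < n)
    {ζ : Fin n → ℂ} {ξ : Fin m → ℂ} (h : StrictlyInterlaces (Set.range ξ) (Set.range ζ))
    (hζ : ∀ j, ‖ζ j‖ = 1) (hξ : ∀ k, ‖ξ k‖ = 1) (hξinj : Function.Injective ξ)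
    (hdisj : Disjoint (Set.range ζ) (Set.range ξ)) :
    ∃ ω ∈ positiveWeights ζ ξ, ∃ ω' ∈ positiveWeights ζ ξ, ¬ ∃ c : ℝ, ∀ j, ω' j = c * ω j := by
  obtain ⟨κ, hκ⟩ := exists_nonneg_weights hm (hm.trans hmn) h hζ hξ hξinj hdisj
  choose w hw0 hwpos hwκ hworth using hκ
  obtain ⟨i, i', hii, hκi⟩ := Fintype.exists_ne_map_eq_of_card_lt κ (by simpa using hmn)
  set ω : Fin n → ℝ := fun j => ∑ j₀, w j₀ j with hω
  have hωpos : ∀ j, 0 < ω j := fun j =>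
    Finset.sum_pos' (fun j₀ _ => hw0 j₀ j) ⟨j, Finset.mem_univ _, hwpos j⟩
  have hωorth : ∀ l, 1 ≤ l → l + 1 ≤ m → nodeForm ω ζ (nodePoly ξ) (X ^ l) = 0 := by
    intro l hl hlm
    have : nodeForm ω ζ (nodePoly ξ) (X ^ l) = ∑ j₀, nodeForm (w j₀) ζ (nodePoly ξ) (X ^ l) := by
      simp only [nodeForm, hω, Complex.ofReal_sum, Finset.sum_mul]
      rw [Finset.sum_comm]
    rw [this, Finset.sum_eq_zero fun j₀ _ => hworth j₀ l hl hlm]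
  refine ⟨ω, (mem_positiveWeights_iff hζ ξ).mpr ⟨hωpos, hωorth⟩, fun j => ω j + w i j,
    (mem_positiveWeights_iff hζ ξ).mpr ⟨fun j => add_pos_of_pos_of_nonneg (hωpos j) (hw0 i j),
      fun l hl hlm => ?_⟩, ?_⟩
  · have : nodeForm (fun j => ω j + w i j) ζ (nodePoly ξ) (X ^ l) =
        nodeForm ω ζ (nodePoly ξ) (X ^ l) + nodeForm (w i) ζ (nodePoly ξ) (X ^ l) := by
      simp only [nodeForm, ← Finset.sum_add_distrib]
      exact Finset.sum_congr rfl fun j _ => by push_cast; ring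
    rw [this, hωorth l hl hlm, hworth i l hl hlm, add_zero]
  · rintro ⟨c, hc⟩
    have h1 := hc i'
    have h2 := hc i
    simp only [hwκ i i' hii.symm hκi.symm, add_zero] at h1 h2
    have h3 : c = 1 := by
      have := hωpos i'
      field_simp at h1
      linarith
    rw [h3] at h2
    linarith [hwpos i]

/-! ### Solutions and weights -/

section

variable {m n : ℕ} {hmn : m + 1 < n + 1} {ζ : Fin (n + 1) → ℂ} {ξ : Fin (m + 1) → ℂ}

lemma norm_boundaryParam {N : ℕ} {ζ : Fin N → ℂ} (hζ : ∀ j, ‖ζ j‖ = 1) :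
    ‖boundaryParam ζ‖ = 1 := by
  rw [boundaryParam, norm_neg, RCLike.norm_conj, norm_nodePoly_eval_zero hζ]

/-- Every choice of positive weights gives a solution: the polynomials `Ψ_n` and `Ψ_m` are
orthogonal to `z, …, z^{n-1}` and `z, …, z^{m-1}`, the first one because it vanishes at all
nodes, hence they are paraorthogonal polynomials of the measure. -/
lemma isTwoSpectraSolution_of_isSzegoSeq (hζ : ∀ j, ‖ζ j‖ = 1) (hξ : ∀ k, ‖ξ k‖ = 1)
    (hζinj : Function.Injective ζ) (hξinj : Function.Injective ξ) {ω : Fin (n + 1) → ℝ}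
    (hω : ω ∈ positiveWeights ζ ξ) {a : ℕ → ℂ} (ha : IsSzegoSeq ω ζ a)
    {α : Fin (n + 1 - 1) → ℂ} (hα : ∀ k, α k = a k) :
    IsTwoSpectraSolution hmn (Set.range ζ) (Set.range ξ) α (boundaryParam ζ) (boundaryParam ξ) := by
  obtain ⟨hpos, horth⟩ := (mem_positiveWeights_iff hζ ξ).mp hω
  rw [isTwoSpectraSolution_iff hmn hζinj hξinj α _ _ a fun k => (hα k).symm]
  refine ⟨fun k hk => ha.norm_lt_one hpos hζ hζinj (by omega), norm_boundaryParam hζ,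
    norm_boundaryParam hξ, ?_, ?_⟩
  · have h := ha.eq_of_orthogonal hpos hζ hζinj n.lt_succ_self (nodePoly_monic ζ)
      (nodePoly_natDegree ζ) fun i _ _ => Finset.sum_eq_zero fun j _ => by
        rw [(nodePoly_eval_eq_zero_iff ζ _).mpr ⟨j, rfl⟩]; simp
    rw [h]
    simp [boundaryParam]
  · have h := ha.eq_of_orthogonal hpos hζ hζinj (by omega) (nodePoly_monic ξ)
      (nodePoly_natDegree ξ) fun i h1 h2 => horth i h1 (by omega)
    rw [h]
    simp [boundaryParam]

lemma eq_boundaryParam {N k : ℕ} {ζ : Fin N → ℂ} {a : ℕ → ℂ} {b : ℂ}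
    (h : X * szego a k - C (conj b) * szegoStar a k = nodePoly ζ) : b = boundaryParam ζ := by
  rw [boundaryParam, ← h]
  simp [szegoStar_eval_zero]

/-- Every solution comes from positive weights, namely from the Christoffel weights. -/
lemma exists_weights_of_isTwoSpectraSolution (hζ : ∀ j, ‖ζ j‖ = 1)
    (hζinj : Function.Injective ζ) (hξinj : Function.Injective ξ)
    {α : Fin (n + 1 - 1) → ℂ} {bn bm : ℂ}
    (h : IsTwoSpectraSolution hmn (Set.range ζ) (Set.range ξ) α bn bm) :
    bn = boundaryParam ζ ∧ bm = boundaryParam ξ ∧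
      ∃ ω ∈ positiveWeights ζ ξ, HasVerblunskyCoeffs (nodeMeasure ω ζ) α := by
  set a : ℕ → ℂ := fun k => if hk : k < n + 1 - 1 then α ⟨k, hk⟩ else 0 with ha
  have hα : ∀ k : Fin (n + 1 - 1), a k = α k := fun k => by
    have := k.2
    simp only [ha]
    rw [dif_pos this]
  obtain ⟨h1, h2, -, h4, h5⟩ := (isTwoSpectraSolution_iff hmn hζinj hξinj α bn bm a hα).mp h
  have hpos := christoffelWeight_pos (ζ := ζ) h1
  have hseq := isSzegoSeq_christoffelWeight h1 hζ hζinj h2 h4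
  refine ⟨eq_boundaryParam h4, eq_boundaryParam h5, christoffelWeight a ζ,
    (mem_positiveWeights_iff hζ ξ).mpr ⟨hpos, fun k hk hkm => ?_⟩,
    (hseq.hasVerblunskyCoeffs_iff hpos hζinj α).mpr fun k => (hα k).symm⟩
  rw [← h5]
  exact hseq.orthogonal_of_eq hζ (by omega) _ hk (by omega)

lemma schurParams_eq_nodeVerblunsky (hζ : ∀ j, ‖ζ j‖ = 1) (hζinj : Function.Injective ζ)
    {ω : Fin (n + 1) → ℝ} (hω : ∀ j, 0 < ω j) (k : Fin (n + 1 - 1)) :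
    schurParams (n + 1) (trigMoment (nodeMeasure ω ζ)) k = nodeVerblunsky ω ζ k :=
  (isSzegoSeq_nodeVerblunsky hω hζ hζinj).schurParams_eq hω hζ hζinj k

end

theorem mainTheorem4 (m n : ℕ) (hm : 1 ≤ m) (hmn : m < n)
    (ζ : Fin n → ℂ) (ξ : Fin m → ℂ)
    (hζ : ∀ j, ‖ζ j‖ = 1) (hξ : ∀ k, ‖ξ k‖ = 1)
    (hζinj : Function.Injective ζ) (hξinj : Function.Injective ξ)
    (hdisj : Disjoint (Set.range ζ) (Set.range ξ)) :
    -- solvability is equivalent to strict interlacing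
    ((∃ (α : Fin (n - 1) → ℂ) (bn bm : ℂ),
        IsTwoSpectraSolution hmn (Set.range ζ) (Set.range ξ) α bn bm) ↔
      StrictlyInterlaces (Set.range ξ) (Set.range ζ)) ∧
    -- there are then strictly positive weights, and the solution is not unique
    (StrictlyInterlaces (Set.range ξ) (Set.range ζ) →
      (positiveWeights ζ ξ).Nonempty ∧
      {s : (Fin (n - 1) → ℂ) × ℂ × ℂ |
        IsTwoSpectraSolution hmn (Set.range ζ) (Set.range ξ) s.1 s.2.1 s.2.2}.Nontrivial) ∧
    -- every choice of weights determines a solution through the truncated moments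
    (∀ ω ∈ positiveWeights ζ ξ,
      (∀ α : Fin (n - 1) → ℂ, HasVerblunskyCoeffs (nodeMeasure ω ζ) α ↔
        α = schurParams n (trigMoment (nodeMeasure ω ζ))) ∧
      IsTwoSpectraSolution hmn (Set.range ζ) (Set.range ξ)
        (schurParams n (trigMoment (nodeMeasure ω ζ))) (boundaryParam ζ) (boundaryParam ξ)) ∧
    -- every solution arises in this way
    (∀ (α : Fin (n - 1) → ℂ) (bn bm : ℂ),
      IsTwoSpectraSolution hmn (Set.range ζ) (Set.range ξ) α bn bm →
      bn = boundaryParam ζ ∧ bm = boundaryParam ξ ∧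
      ∃ ω ∈ positiveWeights ζ ξ, HasVerblunskyCoeffs (nodeMeasure ω ζ) α) := by
  obtain ⟨m, rfl⟩ : ∃ k, m = k + 1 := ⟨m - 1, by omega⟩
  obtain ⟨n, rfl⟩ : ∃ k, n = k + 1 := ⟨n - 1, by omega⟩
  have hsol : ∀ ω ∈ positiveWeights ζ ξ,
      IsTwoSpectraSolution hmn (Set.range ζ) (Set.range ξ)
        (schurParams (n + 1) (trigMoment (nodeMeasure ω ζ)))
        (boundaryParam ζ) (boundaryParam ξ) := fun ω hω =>
    isTwoSpectraSolution_of_isSzegoSeq hζ hξ hζinj hξinj hω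
      (isSzegoSeq_nodeVerblunsky hω.1 hζ hζinj)
      (schurParams_eq_nodeVerblunsky hζ hζinj hω.1)
  refine ⟨⟨?_, fun h => ?_⟩, fun h => ?_, fun ω hω => ⟨fun α => ?_, hsol ω hω⟩,
    fun α bn bm h => exists_weights_of_isTwoSpectraSolution hζ hζinj hξinj h⟩
  · rintro ⟨α, bn, bm, h⟩
    obtain ⟨-, -, ω, hω, -⟩ := exists_weights_of_isTwoSpectraSolution hζ hζinj hξinj h
    exact strictlyInterlaces_of_mem_positiveWeights hζ hdisj hω
  · obtain ⟨ω, hω, -⟩ := exists_positiveWeights_not_proportional hm hmn h hζ hξ hξinj hdisj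
    exact ⟨_, _, _, hsol ω hω⟩
  · obtain ⟨ω, hω, ω', hω', hne⟩ :=
      exists_positiveWeights_not_proportional hm hmn h hζ hξ hξinj hdisj
    refine ⟨⟨ω, hω⟩, (_, _, _), hsol ω hω, (_, _, _), hsol ω' hω', fun heq => hne ?_⟩
    -- equal Verblunsky coefficients mean equal orthogonal polynomials, hence proportional weights
    have hα : schurParams (n + 1) (trigMoment (nodeMeasure ω ζ)) =
        schurParams (n + 1) (trigMoment (nodeMeasure ω' ζ)) := congrArg Prod.fst heq
    have hseq : IsSzegoSeq ω' ζ (nodeVerblunsky ω ζ) := by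
      intro k hk l hl
      have : szego (nodeVerblunsky ω ζ) k = szego (nodeVerblunsky ω' ζ) k := by
        refine szego_congr fun j hj => ?_
        have h1 := congrFun hα ⟨j, by omega⟩
        rwa [schurParams_eq_nodeVerblunsky hζ hζinj hω.1,
          schurParams_eq_nodeVerblunsky hζ hζinj hω'.1] at h1
      rw [this]
      exact isSzegoSeq_nodeVerblunsky hω'.1 hζ hζinj k hk l hl
    exact (isSzegoSeq_nodeVerblunsky hω.1 hζ hζinj).proportional hseq hω.1 hζinj
  · rw [(isSzegoSeq_nodeVerblunsky hω.1 hζ hζinj).hasVerblunskyCoeffs_iff hω.1 hζinj, funext_iff]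
    simp only [schurParams_eq_nodeVerblunsky hζ hζinj hω.1]
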